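/- A nonnegative Borel measure $\nu$ on $\mathbb C$ is called doubling if there is a finite constant $C$ with $\nu(B(z,2r))\le C\,\nu(B(z,r))$ for all $z\in\mathbb C$ and $r>0$. Let $\mathcal W$ be the set of all subharmonic $\mathcal C^2$ functions $\varphi:\mathbb C\to\mathbb R$ such that the measure $\Delta\varphi\,d\lambda$ ($\lambda$ = Lebesgue measure) is doubling and satisfies $\int_{B(z,1)}\Delta\varphi\,d\lambda\ge\delta$ for all $z\in\mathbb C$, with some constant $\delta>0$. For $\varphi\in\mathcal W$ let $L^2_\varphi$ be the Hilbert space of (classes of) measurable functions $f:\mathbb C\to\mathbb C$ with $\int_{\mathbb C}|f|^2e^{-2\varphi}\,d\lambda<\infty$, and let $A^2_\varphi\subset L^2_\varphi$ be the subspace of entire functions in $L^2_\varphi$. **Theorem.** Let $\varphi\in\mathcal W$ and suppose that $\Delta\varphi(z)\to\infty$ as $|z|\to\infty$. Then the canonical solution operator $S:L^2_\varphi\to L^2_\varphi$ to $\overline\partial$ is compact. That is, there is a unique map $S:L^2_\varphi\to L^2_\varphi$ such that, for every $f\in L^2_\varphi$, $\frac{\partial}{\partial\overline z}(Sf)=f$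 in the sense of distributions and $Sf\perp A^2_\varphi$; and this $S$ is a bounded linear operator that is compact. -/

import Mathlib

open MeasureTheory Filter Topology
open scoped NNReal ENNReal ContDiff Laplacian

noncomputable section

namespace DbarPlane

/-- A nonnegative Borel measure on `ℂ` is doubling if `ν (B(z,2r)) ≤ C ν (B(z,r))` for a finite
constant `C` and all `z` and `r > 0`. -/
def IsDoubling (ν : Measure ℂ) : Prop :=
  ∃ C : ℝ≥0, ∀ (z : ℂ) (r : ℝ), 0 < r →
    ν (Metric.ball z (2 * r)) ≤ (C : ℝ≥0∞) * ν (Metric.ball z r)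

/-- The class `𝒟` of doubling measures for which unit balls have mass bounded below by some
`δ > 0`. -/
def ClassD (ν : Measure ℂ) : Prop :=
  IsDoubling ν ∧ ∃ δ : ℝ, 0 < δ ∧ ∀ z : ℂ, ENNReal.ofReal δ ≤ ν (Metric.ball z 1)

/-- Subharmonicity on the whole plane of a real valued (hence nowhere `-∞`) function: upper
semicontinuity and the sub-mean value inequality on all circles. -/
def IsSubharmonic (φ : ℂ → ℝ) : Prop :=
  UpperSemicontinuous φ ∧ ∀ (z : ℂ) (r : ℝ), 0 < r →
    CircleIntegrable φ z r ∧ φ z ≤ Real.circleAverage φ z r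

/-- The measure `Δφ dλ` of a subharmonic `C²` function `φ`. -/
def laplacianMeasure (φ : ℂ → ℝ) : Measure ℂ :=
  (volume : Measure ℂ).withDensity fun z => ENNReal.ofReal ((Δ φ) z)

/-- The class `𝒲` of subharmonic `C²` functions `φ` on `ℂ` such that the measure `Δφ dλ` lies
in `𝒟`. -/
structure ClassW (φ : ℂ → ℝ) : Prop where
  contDiff : ContDiff ℝ 2 φ
  subharmonic : IsSubharmonic φ
  classD : ClassD (laplacianMeasure φ)

/-- The measure `e^{-2φ} dλ`. -/
def weightedMeasure (φ : ℂ → ℝ) : Measure ℂ :=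
  (volume : Measure ℂ).withDensity fun z => ENNReal.ofReal (Real.exp (-2 * φ z))

/-- The Hilbert space `L²_φ = L²(ℂ, e^{-2φ} dλ)`. -/
abbrev L2w (φ : ℂ → ℝ) : Type := Lp ℂ 2 (weightedMeasure φ)

/-- The classical operator `∂/∂z̄ = (∂/∂x + i ∂/∂y) / 2`. -/
def dbar (ψ : ℂ → ℂ) (z : ℂ) : ℂ :=
  (1 / 2 : ℂ) * (fderiv ℝ ψ z 1 + Complex.I * fderiv ℝ ψ z Complex.I)

/-- `∂u/∂z̄ = f` in the sense of distributions on `ℂ`. -/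
def HasWeakDbar (u f : ℂ → ℂ) : Prop :=
  ∀ ψ : ℂ → ℂ, ContDiff ℝ ∞ ψ → HasCompactSupport ψ →
    ∫ z, u z * dbar ψ z = - ∫ z, f z * ψ z

/-- The subspace `A²_φ` of those elements of `L²_φ` that are represented by an entire function. -/
def A2w (φ : ℂ → ℝ) : Submodule ℂ (L2w φ) where
  carrier := {h | ∃ g : ℂ → ℂ, Differentiable ℂ g ∧ h =ᵐ[weightedMeasure φ] g}
  zero_mem' := ⟨0, differentiable_const 0, Lp.coeFn_zero _ _ _⟩
  add_mem' := by
    rintro a b ⟨g, hg, hag⟩ ⟨k, hk, hbk⟩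
    exact ⟨g + k, hg.add hk, (Lp.coeFn_add a b).trans (hag.add hbk)⟩
  smul_mem' := by
    rintro c a ⟨g, hg, hag⟩
    exact ⟨c • g, hg.const_smul c, (Lp.coeFn_smul c a).trans (hag.const_smul c)⟩

/-- `S` is a canonical solution operator to `∂̄` on `L²_φ`: for every `f ∈ L²_φ`, `∂̄ (S f) = f`
and `S f` is orthogonal to `A²_φ`. -/
def IsCanonicalSolutionOperator (φ : ℂ → ℝ) (S : L2w φ → L2w φ) : Prop :=
  ∀ f : L2w φ, HasWeakDbar (S f) f ∧ S f ∈ (A2w φ)ᗮ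

end DbarPlane

end

noncomputable section

namespace DbarPlane

open scoped ComplexConjugate InnerProductSpace Convolution

/-! ### The basic inequality -/

/-! Everything rests on Hörmander's inequality `∫ Δψ |β|² e^{2ψ} ≤ 2 ∫ |∂̄β|² e^{2ψ}` for test
functions `β` (`integral_laplacian_mul_le`), obtained by integrating by parts and discarding a
square. Since `Δφ → ∞`, a bounded perturbation of `φ` has Laplacian `τ ≥ 1` with `τ → ∞`.
Boundedness of the perturbation allows a return to the weight `φ`, so `∫ τ |β|² e^{2φ} ≤ C ∫ |∂̄β|²
e^{2φ}` (`exists_weight`).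

By duality (`exists_dual_solution`) this estimate yields a bounded operator `S` solving `∂̄ (S f) =
f`, with values in the closure of the range of the formal adjoint of `∂̄`. By Weyl's lemma the
orthogonal complement of that range is `A²_φ` (`A2w_eq_orthogonal_rangeDel`), so `S` is canonical.
It is unique because two canonical solutions differ by an element of `A²_φ ∩ (A²_φ)ᗮ`.

Compactness has two sources. Far out `τ` is large, so the same duality shows that `S` has small norm
on data supported outside a large disc (`exists_solution_operator`). Hence `S` is the norm limit of
the operators `S ∘ 1_D` for discs `D`. On data in `D`, convolution with a truncated Cauchy kernel
gives `T` and `T'` with `∂̄ (T f) = 1_D f + T' f`. Projecting `T f` onto `(A²_φ)ᗮ` gives `S ∘ 1_D =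
P T - S T'`. Both `T` and `T'` are compact, being norm limits of truncated convolutions with
continuous kernels, which are of Hilbert–Schmidt type (`IsTruncConv.isCompactOperator`). -/

lemma integral_fderiv_eq_zero {F : Type*} [NormedAddCommGroup F] [NormedSpace ℝ F]
    {g : ℂ → F} (hg : ContDiff ℝ 1 g) (hc : HasCompactSupport g) (v : ℂ) :
    ∫ z, fderiv ℝ g z v = 0 := by
  have hi : Integrable (fun z => fderiv ℝ g z v) (volume : Measure ℂ) := by
    refine Continuous.integrable_of_hasCompactSupport
      ((hg.continuous_fderiv one_ne_zero).clm_apply continuous_const) ?_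
    exact (hc.fderiv ℝ).comp_left (g := fun L : ℂ →L[ℝ] F => L v) rfl
  have := integral_smul_fderiv_eq_neg_fderiv_smul_of_integrable (𝕜 := ℝ) (μ := (volume : Measure ℂ))
    (f := fun _ => (1 : ℝ)) (g := g) (v := v) (by simp) (by simpa using hi)
    (by simpa using hg.continuous.integrable_of_hasCompactSupport hc)
    (by fun_prop) (fun x _ => hg.differentiable one_ne_zero x)
  simpa using this

lemma laplacian_eq_fderiv_fderiv {ψ : ℂ → ℝ} (hψ : ContDiff ℝ 2 ψ) (z : ℂ) :
    (Δ ψ) z = fderiv ℝ (fun w => fderiv ℝ ψ w 1) z 1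
      + fderiv ℝ (fun w => fderiv ℝ ψ w Complex.I) z Complex.I := by
  have hd : DifferentiableAt ℝ (fderiv ℝ ψ) z :=
    (hψ.fderiv_right (m := 1) (by norm_num)).differentiable one_ne_zero z
  rw [InnerProductSpace.laplacian_eq_iteratedFDeriv_complexPlane]
  simp only [iteratedFDeriv_two_apply]
  rw [fderiv_clm_apply hd (by fun_prop), fderiv_clm_apply hd (by fun_prop)]
  simp

lemma fderiv_comm {ψ : ℂ → ℝ} (hψ : ContDiff ℝ 2 ψ) (z v w : ℂ) :
    fderiv ℝ (fun ζ => fderiv ℝ ψ ζ v) z w = fderiv ℝ (fun ζ => fderiv ℝ ψ ζ w) z v := by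
  have hd : DifferentiableAt ℝ (fderiv ℝ ψ) z :=
    (hψ.fderiv_right (m := 1) (by norm_num)).differentiable one_ne_zero z
  rw [fderiv_clm_apply hd (by fun_prop), fderiv_clm_apply hd (by fun_prop)]
  have := (hψ.contDiffAt (x := z)).isSymmSndFDerivAt (by simp)
  simpa using this.eq w v

lemma continuous_laplacian {ψ : ℂ → ℝ} (hψ : ContDiff ℝ 2 ψ) : Continuous (Δ ψ) := by
  have hd : ContDiff ℝ 1 (fderiv ℝ ψ) := hψ.fderiv_right (m := 1) (by norm_num)
  have h : ∀ v : ℂ, Continuous fun z => fderiv ℝ (fun w => fderiv ℝ ψ w v) z v := fun v =>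
    (((hd.clm_apply contDiff_const).continuous_fderiv one_ne_zero).clm_apply continuous_const)
  exact ((h 1).add (h Complex.I)).congr fun z => (laplacian_eq_fderiv_fderiv hψ z).symm

lemma continuous_dbar {β : ℂ → ℂ} (hβ : ContDiff ℝ 1 β) : Continuous (dbar β) := by
  have h : ∀ v : ℂ, Continuous fun z => fderiv ℝ β z v := fun v =>
    (hβ.continuous_fderiv one_ne_zero).clm_apply continuous_const
  unfold dbar
  exact continuous_const.mul ((h 1).add (continuous_const.mul (h Complex.I)))

lemma hasCompactSupport_dbar {β : ℂ → ℂ} (hc : HasCompactSupport β) :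
    HasCompactSupport (dbar β) :=
  (hc.fderiv ℝ).comp_left
    (g := fun L : ℂ →L[ℝ] ℂ => (1 / 2 : ℂ) * (L 1 + Complex.I * L Complex.I)) (by simp)

lemma norm_dbar_sq {a b : ℂ → ℝ} {β : ℂ → ℂ} {z : ℂ} (hβ : DifferentiableAt ℝ β z)
    (ha : a = fun z => (β z).re) (hb : b = fun z => (β z).im) :
    4 * ‖dbar β z‖ ^ 2 = (fderiv ℝ a z 1 - fderiv ℝ b z Complex.I) ^ 2
      + (fderiv ℝ b z 1 + fderiv ℝ a z Complex.I) ^ 2 := by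
  have h1 : fderiv ℝ a z = Complex.reCLM.comp (fderiv ℝ β z) := by
    rw [ha]; exact (Complex.reCLM.hasFDerivAt.comp z hβ.hasFDerivAt).fderiv
  have h2 : fderiv ℝ b z = Complex.imCLM.comp (fderiv ℝ β z) := by
    rw [hb]; exact (Complex.imCLM.hasFDerivAt.comp z hβ.hasFDerivAt).fderiv
  rw [h1, h2, Complex.sq_norm, Complex.normSq_apply, dbar]
  simp
  ring

/-- A divergence identity for `|∂̄β|² e^{2ψ}` in real coordinates. -/
lemma four_norm_dbar_sq_mul_exp {ψ a b : ℂ → ℝ} {β : ℂ → ℂ} (hψ : ContDiff ℝ 2 ψ)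
    (hβ : ContDiff ℝ 2 β)
    (ha : a = fun z => (β z).re) (hb : b = fun z => (β z).im) (z : ℂ) :
    4 * ‖dbar β z‖ ^ 2 * Real.exp (2 * ψ z) =
      Real.exp (2 * ψ z) * ((fderiv ℝ a z 1 + fderiv ℝ b z Complex.I
          + 2 * fderiv ℝ ψ z 1 * a z + 2 * fderiv ℝ ψ z Complex.I * b z) ^ 2
        + (fderiv ℝ b z 1 - fderiv ℝ a z Complex.I
          + 2 * fderiv ℝ ψ z 1 * b z - 2 * fderiv ℝ ψ z Complex.I * a z) ^ 2)
      - 4 * (fderiv ℝ (fun w => ((a w * fderiv ℝ b w Complex.I - b w * fderiv ℝ a w Complex.I)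
            + fderiv ℝ ψ w 1 * (a w ^ 2 + b w ^ 2)) * Real.exp (2 * ψ w) / 2) z 1
          + fderiv ℝ (fun w => ((b w * fderiv ℝ a w 1 - a w * fderiv ℝ b w 1)
            + fderiv ℝ ψ w Complex.I * (a w ^ 2 + b w ^ 2)) * Real.exp (2 * ψ w) / 2) z Complex.I)
      + 2 * ((Δ ψ) z * ‖β z‖ ^ 2 * Real.exp (2 * ψ z)) := by
  have hac : ContDiff ℝ 2 a := by rw [ha]; exact Complex.reCLM.contDiff.comp hβ
  have hbc : ContDiff ℝ 2 b := by rw [hb]; exact Complex.imCLM.contDiff.comp hβ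
  have hd : ∀ {f : ℂ → ℝ}, ContDiff ℝ 2 f → ∀ v, HasFDerivAt (fun w => fderiv ℝ f w v)
      (fderiv ℝ (fun w => fderiv ℝ f w v) z) z := fun hf v =>
    ((((hf.fderiv_right (m := 1) (by norm_num)).clm_apply contDiff_const).differentiable
      one_ne_zero) z).hasFDerivAt
  have hd0 : ∀ {f : ℂ → ℝ}, ContDiff ℝ 2 f → HasFDerivAt f (fderiv ℝ f z) z := fun hf =>
    (hf.differentiable two_ne_zero z).hasFDerivAt
  have hE := ((hd0 hψ).const_mul 2).exp
  have hsq := ((hd0 hac).pow 2).add ((hd0 hbc).pow 2)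
  have F1 := (((((hd0 hac).mul (hd hbc Complex.I)).sub ((hd0 hbc).mul (hd hac Complex.I))).add
    ((hd hψ 1).mul hsq)).mul hE).mul_const (2⁻¹ : ℝ)
  have F2 := (((((hd0 hbc).mul (hd hac 1)).sub ((hd0 hac).mul (hd hbc 1))).add
    ((hd hψ Complex.I).mul hsq)).mul hE).mul_const (2⁻¹ : ℝ)
  have e1 : fderiv ℝ (fun w => ((a w * fderiv ℝ b w Complex.I - b w * fderiv ℝ a w Complex.I)
            + fderiv ℝ ψ w 1 * (a w ^ 2 + b w ^ 2)) * Real.exp (2 * ψ w) / 2) z = _ := F1.fderiv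
  have e2 : fderiv ℝ (fun w => ((b w * fderiv ℝ a w 1 - a w * fderiv ℝ b w 1)
            + fderiv ℝ ψ w Complex.I * (a w ^ 2 + b w ^ 2)) * Real.exp (2 * ψ w) / 2) z = _ :=
    F2.fderiv
  have hn : ‖β z‖ ^ 2 = a z ^ 2 + b z ^ 2 := by
    rw [Complex.sq_norm, Complex.normSq_apply, ha, hb]; ring
  rw [e1, e2, norm_dbar_sq (hβ.differentiable two_ne_zero z) ha hb, hn,
    laplacian_eq_fderiv_fderiv hψ]
  -- The two components of the divergence produce the mixed second derivatives of `a` and `b` with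
  -- opposite signs. Once these cancel, the identity is polynomial in the remaining derivatives.
  have c1 := fderiv_comm hac z 1 Complex.I
  have c2 := fderiv_comm hbc z 1 Complex.I
  simp only [add_apply, sub_apply, smul_apply, smul_eq_mul, Pi.add_apply, Pi.mul_apply, Pi.sub_apply, c1, c2, Nat.add_one_sub_one, pow_one]
  ring

lemma integrable_of_eq_zero {β : ℂ → ℂ} (hc : HasCompactSupport β) {F : ℂ → ℝ}
    (hF : Continuous F) (h : ∀ z, β z = 0 → F z = 0) : Integrable F (volume : Measure ℂ) := by
  refine hF.integrable_of_hasCompactSupport (hc.mono fun z hz => ?_)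
  contrapose! hz
  rw [Function.notMem_support] at hz ⊢
  exact h z hz

/-- Hörmander's basic inequality, dual form in the plane. -/
lemma integral_laplacian_mul_le {ψ : ℂ → ℝ} {β : ℂ → ℂ} (hψ : ContDiff ℝ 2 ψ)
    (hβ : ContDiff ℝ 2 β) (hc : HasCompactSupport β) :
    ∫ z, (Δ ψ) z * ‖β z‖ ^ 2 * Real.exp (2 * ψ z)
      ≤ 2 * ∫ z, ‖dbar β z‖ ^ 2 * Real.exp (2 * ψ z) := by
  obtain ⟨a, ha⟩ : ∃ a : ℂ → ℝ, a = fun z => (β z).re := ⟨_, rfl⟩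
  obtain ⟨b, hb⟩ : ∃ b : ℂ → ℝ, b = fun z => (β z).im := ⟨_, rfl⟩
  have hac : ContDiff ℝ 2 a := by rw [ha]; exact Complex.reCLM.contDiff.comp hβ
  have hbc : ContDiff ℝ 2 b := by rw [hb]; exact Complex.imCLM.contDiff.comp hβ
  have hd : ∀ {f : ℂ → ℝ}, ContDiff ℝ 2 f → ∀ v, ContDiff ℝ 1 (fun w => fderiv ℝ f w v) :=
    fun hf v => (hf.fderiv_right (m := 1) (by norm_num)).clm_apply contDiff_const
  have hψ1 : ContDiff ℝ 1 ψ := hψ.of_le (by norm_num)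
  have hac1 : ContDiff ℝ 1 a := hac.of_le (by norm_num)
  have hbc1 : ContDiff ℝ 1 b := hbc.of_le (by norm_num)
  obtain ⟨F1, hF1⟩ : ∃ F : ℂ → ℝ, F = fun w =>
    ((a w * fderiv ℝ b w Complex.I - b w * fderiv ℝ a w Complex.I)
      + fderiv ℝ ψ w 1 * (a w ^ 2 + b w ^ 2)) * Real.exp (2 * ψ w) / 2 := ⟨_, rfl⟩
  obtain ⟨F2, hF2⟩ : ∃ F : ℂ → ℝ, F = fun w =>
    ((b w * fderiv ℝ a w 1 - a w * fderiv ℝ b w 1)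
      + fderiv ℝ ψ w Complex.I * (a w ^ 2 + b w ^ 2)) * Real.exp (2 * ψ w) / 2 := ⟨_, rfl⟩
  have hE : ContDiff ℝ 1 fun w => Real.exp (2 * ψ w) := (contDiff_const.mul hψ1).exp
  have hF1c : ContDiff ℝ 1 F1 := by
    rw [hF1]
    exact ((((hac1.mul (hd hbc _)).sub (hbc1.mul (hd hac _))).add
      ((hd hψ _).mul ((hac1.pow 2).add (hbc1.pow 2)))).mul hE).div_const 2
  have hF2c : ContDiff ℝ 1 F2 := by
    rw [hF2]
    exact ((((hbc1.mul (hd hac _)).sub (hac1.mul (hd hbc _))).add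
      ((hd hψ _).mul ((hac1.pow 2).add (hbc1.pow 2)))).mul hE).div_const 2
  have hsupp : ∀ F : ℂ → ℝ, (∀ z, a z = 0 → b z = 0 → F z = 0) → HasCompactSupport F := by
    intro F hF
    refine hc.mono fun z hz => ?_
    contrapose! hz
    rw [Function.notMem_support] at hz ⊢
    exact hF z (by simp [ha, hz]) (by simp [hb, hz])
  have hF1s : HasCompactSupport F1 := hsupp _ fun z h1 h2 => by simp [hF1, h1, h2]
  have hF2s : HasCompactSupport F2 := hsupp _ fun z h1 h2 => by simp [hF2, h1, h2]
  have hi : ∀ {F : ℂ → ℝ}, ContDiff ℝ 1 F → HasCompactSupport F → ∀ v,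
      Integrable (fun z => fderiv ℝ F z v) (volume : Measure ℂ) := fun hF hs v =>
    Continuous.integrable_of_hasCompactSupport
      ((hF.continuous_fderiv one_ne_zero).clm_apply continuous_const)
      ((hs.fderiv ℝ).comp_left (g := fun L : ℂ →L[ℝ] ℝ => L v) rfl)
  have hiG : Integrable (fun z => (Δ ψ) z * ‖β z‖ ^ 2 * Real.exp (2 * ψ z))
      (volume : Measure ℂ) :=
    integrable_of_eq_zero hc (((continuous_laplacian hψ).mul (hβ.continuous.norm.pow 2)).mul
      hE.continuous) fun z hz => by simp [hz]
  have hiD : Integrable (fun z => ‖dbar β z‖ ^ 2 * Real.exp (2 * ψ z)) (volume : Measure ℂ) :=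
    integrable_of_eq_zero (hasCompactSupport_dbar hc)
      (((continuous_dbar (hβ.of_le (by norm_num))).norm.pow 2).mul hE.continuous)
      fun z hz => by simp [hz]
  have hiF : Integrable (fun z => fderiv ℝ F1 z 1 + fderiv ℝ F2 z Complex.I)
      (volume : Measure ℂ) := (hi hF1c hF1s _).add (hi hF2c hF2s _)
  have key : ∫ z, 2 * ((Δ ψ) z * ‖β z‖ ^ 2 * Real.exp (2 * ψ z)) ≤
      ∫ z, (4 * (‖dbar β z‖ ^ 2 * Real.exp (2 * ψ z))
        + 4 * (fderiv ℝ F1 z 1 + fderiv ℝ F2 z Complex.I)) := by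
    refine integral_mono (hiG.const_mul 2)
      ((hiD.const_mul 4).add (hiF.const_mul 4)) fun z => ?_
    have := four_norm_dbar_sq_mul_exp hψ hβ ha hb z
    rw [← hF1, ← hF2] at this
    -- This is the discarded square `4 e^{-2ψ} |∂(e^{2ψ} β)|²`, the weighted adjoint of `∂̄` applied
    -- to `e^{2ψ} β`, up to constants.
    have hn : 0 ≤ Real.exp (2 * ψ z) * ((fderiv ℝ a z 1 + fderiv ℝ b z Complex.I
          + 2 * fderiv ℝ ψ z 1 * a z + 2 * fderiv ℝ ψ z Complex.I * b z) ^ 2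
        + (fderiv ℝ b z 1 - fderiv ℝ a z Complex.I
          + 2 * fderiv ℝ ψ z 1 * b z - 2 * fderiv ℝ ψ z Complex.I * a z) ^ 2) := by positivity
    dsimp only
    linarith
  rw [integral_add (hiD.const_mul 4) (hiF.const_mul 4),
    integral_const_mul, integral_const_mul, integral_const_mul,
    integral_add (hi hF1c hF1s _) (hi hF2c hF2s _), integral_fderiv_eq_zero hF1c hF1s,
    integral_fderiv_eq_zero hF2c hF2s] at key
  linarith

/-- The bounded perturbation `-R⁴ / (R² + |z|²)`, whose Laplacian is large near the origin. -/
def bump (R : ℝ) (z : ℂ) : ℝ := -R ^ 4 / (R ^ 2 + (z.re ^ 2 + z.im ^ 2))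

lemma contDiff_bump {R : ℝ} (hR : 0 < R) : ContDiff ℝ 2 (bump R) := by
  have h1 : ContDiff ℝ 2 Complex.re := Complex.reCLM.contDiff
  have h2 : ContDiff ℝ 2 Complex.im := Complex.imCLM.contDiff
  exact contDiff_const.div (contDiff_const.add ((h1.pow 2).add (h2.pow 2)))
    fun z => by positivity

lemma laplacian_bump {R : ℝ} (hR : 0 < R) (z : ℂ) :
    (Δ (bump R)) z = 4 * R ^ 4 * (R ^ 2 - (z.re ^ 2 + z.im ^ 2))
      / (R ^ 2 + (z.re ^ 2 + z.im ^ 2)) ^ 3 := by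
  have hQ : ∀ z : ℂ, HasFDerivAt (fun w : ℂ => R ^ 2 + (w.re ^ 2 + w.im ^ 2))
      ((2 * z.re) • Complex.reCLM + (2 * z.im) • Complex.imCLM) z := fun z => by
    have := (((Complex.reCLM.hasFDerivAt (x := z)).pow 2).add
      ((Complex.imCLM.hasFDerivAt (x := z)).pow 2)).const_add (R ^ 2)
    simpa using this
  have hpos : ∀ z : ℂ, R ^ 2 + (z.re ^ 2 + z.im ^ 2) ≠ 0 := fun z => by positivity
  have hf : ∀ z, HasFDerivAt (bump R) _ z := fun z =>
    ((hasDerivAt_inv (hpos z)).comp_hasFDerivAt z (hQ z)).const_mul (-R ^ 4)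
  have h1 : (fun w => fderiv ℝ (bump R) w 1) = fun w =>
      (2 * R ^ 4) * (w.re * ((R ^ 2 + (w.re ^ 2 + w.im ^ 2)) ^ 2)⁻¹) := by
    ext w; rw [(hf w).fderiv]; simp; ring
  have h2 : (fun w => fderiv ℝ (bump R) w Complex.I) = fun w =>
      (2 * R ^ 4) * (w.im * ((R ^ 2 + (w.re ^ 2 + w.im ^ 2)) ^ 2)⁻¹) := by
    ext w; rw [(hf w).fderiv]; simp; ring
  have hQ2 := (hasDerivAt_inv (pow_ne_zero 2 (hpos z))).comp_hasFDerivAt z ((hQ z).pow 2)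
  have e1 : fderiv ℝ (fun w : ℂ => (2 * R ^ 4) *
      (w.re * ((R ^ 2 + (w.re ^ 2 + w.im ^ 2)) ^ 2)⁻¹)) z = _ :=
    (((Complex.reCLM.hasFDerivAt (x := z)).mul hQ2).const_mul (2 * R ^ 4)).fderiv
  have e2 : fderiv ℝ (fun w : ℂ => (2 * R ^ 4) *
      (w.im * ((R ^ 2 + (w.re ^ 2 + w.im ^ 2)) ^ 2)⁻¹)) z = _ :=
    (((Complex.imCLM.hasFDerivAt (x := z)).mul hQ2).const_mul (2 * R ^ 4)).fderiv
  rw [laplacian_eq_fderiv_fderiv (contDiff_bump hR), h1, h2, e1, e2]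
  have := hpos z
  simp
  field_simp
  ring

/-- This bound and the bound on the disc of radius `R / 2` are both independent of `R`, so the
multiple of `bump R` to be added can be fixed before `R` is chosen. -/
lemma neg_four_le_laplacian_bump {R : ℝ} (hR : 0 < R) (z : ℂ) : -4 ≤ (Δ (bump R)) z := by
  rw [laplacian_bump hR, le_div_iff₀ (by positivity)]
  have h : 0 ≤ z.re ^ 2 + z.im ^ 2 := by positivity
  have hR2 : 0 ≤ R ^ 2 := by positivity
  generalize z.re ^ 2 + z.im ^ 2 = s at *
  have : R ^ 4 = (R ^ 2) ^ 2 := by ring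
  rw [this]
  generalize R ^ 2 = r at *
  nlinarith [mul_nonneg hR2 h, mul_nonneg hR2 (mul_nonneg hR2 h), mul_nonneg hR2 (mul_nonneg h h),
    pow_nonneg h 3, pow_nonneg hR2 3]

lemma one_le_laplacian_bump {R : ℝ} (hR : 0 < R) {z : ℂ} (hz : ‖z‖ ≤ R / 2) :
    1 ≤ (Δ (bump R)) z := by
  rw [laplacian_bump hR, le_div_iff₀ (by positivity)]
  have h : 0 ≤ z.re ^ 2 + z.im ^ 2 := by positivity
  have hR2 : 0 ≤ R ^ 2 := by positivity
  have hz2 : z.re ^ 2 + z.im ^ 2 ≤ R ^ 2 / 4 := by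
    have h1 : ‖z‖ ^ 2 ≤ (R / 2) ^ 2 := by gcongr
    rw [Complex.sq_norm, Complex.normSq_apply] at h1
    nlinarith
  generalize z.re ^ 2 + z.im ^ 2 = s at *
  have : R ^ 4 = (R ^ 2) ^ 2 := by ring
  rw [this]
  generalize R ^ 2 = r at *
  have h3 : (r + s) ^ 3 ≤ (r + r / 4) ^ 3 := by gcongr
  have h4 : 4 * r ^ 2 * (r - r / 4) ≤ 4 * r ^ 2 * (r - s) := by gcongr
  nlinarith [pow_nonneg hR2 3]

lemma bump_nonpos (R : ℝ) (z : ℂ) : bump R z ≤ 0 :=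
  div_nonpos_of_nonpos_of_nonneg (by nlinarith [sq_nonneg (R ^ 2)]) (by positivity)

lemma neg_sq_le_bump {R : ℝ} (hR : 0 < R) (z : ℂ) : -R ^ 2 ≤ bump R z := by
  rw [bump, le_div_iff₀ (by positivity)]
  nlinarith [mul_nonneg (sq_nonneg R) (add_nonneg (sq_nonneg z.re) (sq_nonneg z.im))]

/-- If `Δφ → ∞` then `φ` has a bounded perturbation whose Laplacian is at least one everywhere;
this yields a weighted inequality for `φ` itself. -/
lemma exists_weight {φ : ℂ → ℝ} (hφ : ContDiff ℝ 2 φ)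
    (hΔ : Tendsto (fun z : ℂ => (Δ φ) z) (cocompact ℂ) atTop) :
    ∃ (τ : ℂ → ℝ) (C : ℝ), 0 < C ∧ Continuous τ ∧ (∀ z, 1 ≤ τ z) ∧
      Tendsto τ (cocompact ℂ) atTop ∧
      ∀ β : ℂ → ℂ, ContDiff ℝ ∞ β → HasCompactSupport β →
        ∫ z, τ z * ‖β z‖ ^ 2 * Real.exp (2 * φ z)
          ≤ C * ∫ z, ‖dbar β z‖ ^ 2 * Real.exp (2 * φ z) := by
  obtain ⟨z₀, hz₀⟩ := (continuous_laplacian hφ).exists_forall_le hΔ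
  -- `N` lifts the minimum of `Δφ` to at least `1` on the inner disc. Outside it the perturbation
  -- costs at most `4 N`, whence the threshold `4 * N + 1`.
  obtain ⟨N, hN0, hN⟩ : ∃ N : ℝ, 0 ≤ N ∧ 1 ≤ (Δ φ) z₀ + N :=
    ⟨|1 - (Δ φ) z₀|, abs_nonneg _, by linarith [le_abs_self (1 - (Δ φ) z₀)]⟩
  have hev := hΔ.eventually (eventually_ge_atTop (4 * N + 1))
  rw [← Metric.cobounded_eq_cocompact, ← comap_norm_atTop, eventually_comap,
    eventually_atTop] at hev
  obtain ⟨r, hr⟩ := hev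
  obtain ⟨R, hR, hrR⟩ : ∃ R : ℝ, 0 < R ∧ r ≤ R / 2 :=
    ⟨2 * max r 1, by positivity, by linarith [le_max_left r 1]⟩
  have hb : ContDiff ℝ 2 fun z => N * bump R z := contDiff_const.mul (contDiff_bump hR)
  have hL : ∀ z, (Δ (fun z => φ z + N * bump R z)) z = (Δ φ) z + N * (Δ (bump R)) z := by
    intro z
    have h1 := hφ.contDiffAt.laplacian_add (x := z) hb.contDiffAt
    have h2 := InnerProductSpace.laplacian_smul N (contDiff_bump hR).contDiffAt (x := z)
    have h3 : (N • bump R) = fun z => N * bump R z := rfl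
    rw [h3, smul_eq_mul] at h2
    rw [← h2]
    exact h1
  have hψ : ContDiff ℝ 2 (fun z => φ z + N * bump R z) := hφ.add hb
  have h0 : ∀ z, 1 ≤ (Δ (fun z => φ z + N * bump R z)) z := by
    intro z
    rw [hL]
    by_cases hz : ‖z‖ ≤ R / 2
    · nlinarith [one_le_laplacian_bump hR hz, hz₀ z]
    · nlinarith [neg_four_le_laplacian_bump hR z, hr ‖z‖ (by linarith) z rfl]
  -- The factor `2` is that of the basic inequality; the exponential comes from `-N R² ≤ N * bump R
  -- ≤ 0`, which compares the two weights.
  refine ⟨Δ (fun z => φ z + N * bump R z), 2 * Real.exp (2 * (N * R ^ 2)), by positivity,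
    continuous_laplacian hψ, h0, ?_, fun β hβ hc => ?_⟩
  · refine tendsto_atTop.2 fun b => ?_
    filter_upwards [hΔ.eventually_ge_atTop (b + 4 * N)] with z hz
    rw [hL]
    nlinarith [neg_four_le_laplacian_bump hR z]
  · have hβ2 : ContDiff ℝ 2 β := by exact_mod_cast contDiff_infty.1 hβ 2
    have hLc := continuous_laplacian hψ
    have hDc : Continuous (dbar β) := continuous_dbar (hβ2.of_le (by norm_num))
    have hφc := hφ.continuous
    have hψc := hψ.continuous
    have hβc := hβ.continuous
    have h1 := integral_laplacian_mul_le hψ hβ2 hc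
    have h2 : ∫ z, (Δ (fun z => φ z + N * bump R z)) z * ‖β z‖ ^ 2 * Real.exp (2 * φ z) ≤
        ∫ z, Real.exp (2 * (N * R ^ 2)) * ((Δ (fun z => φ z + N * bump R z)) z * ‖β z‖ ^ 2
          * Real.exp (2 * (φ z + N * bump R z))) := by
      refine integral_mono (integrable_of_eq_zero hc (by fun_prop) fun z hz => by simp [hz])
        (integrable_of_eq_zero hc (by fun_prop) fun z hz => by simp [hz]) fun z => ?_
      have : Real.exp (2 * φ z) ≤
          Real.exp (2 * (N * R ^ 2)) * Real.exp (2 * (φ z + N * bump R z)) := by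
        rw [← Real.exp_add, Real.exp_le_exp]
        nlinarith [neg_sq_le_bump hR z]
      calc _ ≤ _ := mul_le_mul_of_nonneg_left this
            (mul_nonneg (zero_le_one.trans (h0 z)) (sq_nonneg _))
        _ = _ := by ring
    have h3 : ∫ z, ‖dbar β z‖ ^ 2 * Real.exp (2 * (φ z + N * bump R z)) ≤
        ∫ z, ‖dbar β z‖ ^ 2 * Real.exp (2 * φ z) := by
      refine integral_mono
        (integrable_of_eq_zero (hasCompactSupport_dbar hc) (by fun_prop) fun z hz => by simp [hz])
        (integrable_of_eq_zero (hasCompactSupport_dbar hc) (by fun_prop) fun z hz => by simp [hz])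
        fun z => ?_
      have : Real.exp (2 * (φ z + N * bump R z)) ≤ Real.exp (2 * φ z) := by
        rw [Real.exp_le_exp]
        nlinarith [bump_nonpos R z]
      exact mul_le_mul_of_nonneg_left this (sq_nonneg _)
    rw [integral_const_mul] at h2
    nlinarith [Real.exp_pos (2 * (N * R ^ 2))]

/-! ### The weighted measure -/

section Weighted

variable {φ : ℂ → ℝ}

lemma measurable_weight (hφ : Continuous φ) :
    Measurable fun z => ENNReal.ofReal (Real.exp (-2 * φ z)) :=
  ENNReal.measurable_ofReal.comp (by fun_prop : Continuous fun z => Real.exp (-2 * φ z)).measurable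

lemma volume_absolutelyContinuous (hφ : Continuous φ) :
    (volume : Measure ℂ) ≪ weightedMeasure φ :=
  withDensity_absolutelyContinuous' (measurable_weight hφ).aemeasurable
    (ae_of_all _ fun z => by simp [Real.exp_pos])

lemma weightedMeasure_absolutelyContinuous : weightedMeasure φ ≪ (volume : Measure ℂ) :=
  withDensity_absolutelyContinuous _ _

lemma ae_weightedMeasure (hφ : Continuous φ) : ae (weightedMeasure φ) = ae (volume : Measure ℂ) :=
  le_antisymm weightedMeasure_absolutelyContinuous.ae_le (volume_absolutelyContinuous hφ).ae_le

lemma integral_weightedMeasure (hφ : Continuous φ) {F : Type*} [NormedAddCommGroup F]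
    [NormedSpace ℝ F] (g : ℂ → F) :
    ∫ z, g z ∂(weightedMeasure φ) = ∫ z, Real.exp (-2 * φ z) • g z := by
  rw [weightedMeasure, integral_withDensity_eq_integral_toReal_smul (measurable_weight hφ)
    (ae_of_all _ fun z => ENNReal.ofReal_lt_top)]
  simp [Real.exp_nonneg]

/-- The constant is a bound for `e^{2φ}` on `K`. With its counterpart for `e^{-2φ}`, it reduces
local questions in `L²_φ` to unweighted ones. -/
lemma exists_restrict_le_smul_weightedMeasure (hφ : Continuous φ) {K : Set ℂ} (hK : IsCompact K) :
    ∃ c : ℝ≥0, (volume : Measure ℂ).restrict K ≤ c • weightedMeasure φ := by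
  obtain ⟨M, hM⟩ := hK.exists_bound_of_continuousOn (f := fun z => Real.exp (2 * φ z))
    (by fun_prop)
  refine ⟨M.toNNReal, Measure.le_iff.2 fun t ht => ?_⟩
  rw [Measure.restrict_apply ht, Measure.smul_apply, weightedMeasure, withDensity_apply _ ht,
    ENNReal.smul_def, smul_eq_mul, ← lintegral_const_mul _ (measurable_weight hφ)]
  have hKm := hK.measurableSet
  calc volume (t ∩ K) = ∫⁻ _ in t ∩ K, 1 := by simp
    _ ≤ ∫⁻ z in t ∩ K, (M.toNNReal : ℝ≥0∞) * ENNReal.ofReal (Real.exp (-2 * φ z)) := by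
        refine setLIntegral_mono' (ht.inter hKm) fun z hz => ?_
        have h1 := hM z hz.2
        rw [Real.norm_of_nonneg (Real.exp_nonneg _)] at h1
        rw [← ENNReal.ofReal, ← ENNReal.ofReal_mul ((Real.exp_nonneg _).trans h1),
          ENNReal.one_le_ofReal]
        calc (1 : ℝ) = Real.exp (2 * φ z) * Real.exp (-2 * φ z) := by
              rw [← Real.exp_add]; simp
          _ ≤ _ := by gcongr
    _ ≤ _ := lintegral_mono_set Set.inter_subset_left

lemma exists_weightedMeasure_restrict_le_smul (hφ : Continuous φ) {K : Set ℂ} (hK : IsCompact K) :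
    ∃ c : ℝ≥0, (weightedMeasure φ).restrict K ≤ c • (volume : Measure ℂ) := by
  obtain ⟨M, hM⟩ := hK.exists_bound_of_continuousOn (f := fun z => Real.exp (-2 * φ z))
    (by fun_prop)
  refine ⟨M.toNNReal, Measure.le_iff.2 fun t ht => ?_⟩
  rw [Measure.restrict_apply ht, Measure.smul_apply, weightedMeasure,
    withDensity_apply _ (ht.inter hK.measurableSet), ENNReal.smul_def, smul_eq_mul]
  calc ∫⁻ z in t ∩ K, ENNReal.ofReal (Real.exp (-2 * φ z))
      ≤ ∫⁻ z in t ∩ K, (M.toNNReal : ℝ≥0∞) := by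
        refine setLIntegral_mono' (ht.inter hK.measurableSet) fun z hz => ?_
        have h1 := hM z hz.2
        rw [Real.norm_of_nonneg (Real.exp_nonneg _)] at h1
        exact ENNReal.ofReal_le_ofReal h1
    _ = M.toNNReal * volume (t ∩ K) := by simp
    _ ≤ _ := by gcongr; exact Set.inter_subset_left

lemma memLp_restrict (hφ : Continuous φ) (f : L2w φ) {K : Set ℂ} (hK : IsCompact K) :
    MemLp f 2 ((volume : Measure ℂ).restrict K) := by
  obtain ⟨c, hc⟩ := exists_restrict_le_smul_weightedMeasure hφ hK
  exact (Lp.memLp f).of_measure_le_smul (c := c) (by simp) (by simpa using hc)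

lemma locallyIntegrable_coe (hφ : Continuous φ) (f : L2w φ) :
    LocallyIntegrable f (volume : Measure ℂ) := by
  rw [locallyIntegrable_iff]
  intro K hK
  have : IsFiniteMeasure ((volume : Measure ℂ).restrict K) := ⟨by simpa using hK.measure_lt_top⟩
  exact (memLp_restrict hφ f hK).integrable (by norm_num)

lemma memLp_of_continuous (hφ : Continuous φ) {g : ℂ → ℂ} (hg : Continuous g)
    (hc : HasCompactSupport g) : MemLp g 2 (weightedMeasure φ) := by
  obtain ⟨c, h⟩ := exists_weightedMeasure_restrict_le_smul hφ hc
  have h1 : MemLp g 2 ((weightedMeasure φ).restrict (tsupport g)) :=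
    (hg.memLp_of_hasCompactSupport (μ := (volume : Measure ℂ)) hc).of_measure_le_smul
      (c := c) (by simp) (by simpa using h)
  rw [← memLp_indicator_iff_restrict hc.measurableSet] at h1
  rwa [Set.indicator_eq_self.2 (subset_tsupport g)] at h1

end Weighted

/-- Continuous functions with compact support, as a space of functions. -/
def CcSubmodule : Submodule ℂ (ℂ → ℂ) where
  carrier := {g | Continuous g ∧ HasCompactSupport g}
  zero_mem' := ⟨continuous_const, HasCompactSupport.zero⟩
  add_mem' ha hb := ⟨ha.1.add hb.1, ha.2.add hb.2⟩
  smul_mem' c _ ha := ⟨ha.1.const_smul c, ha.2.comp_left (g := fun w => c • w) (smul_zero c)⟩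

/-- Test functions, as a space of functions. -/
def testSubmodule : Submodule ℂ (ℂ → ℂ) where
  carrier := {g | ContDiff ℝ ∞ g ∧ HasCompactSupport g}
  zero_mem' := ⟨contDiff_const, HasCompactSupport.zero⟩
  add_mem' ha hb := ⟨ha.1.add hb.1, ha.2.add hb.2⟩
  smul_mem' c _ ha := ⟨contDiff_const.smul ha.1,
    ha.2.comp_left (g := fun w => c • w) (smul_zero c)⟩

/-- `g ↦ e^{2φ} g`, which turns weighted inner products into plain integrals. -/
def expEmbed {φ : ℂ → ℝ} (hφ : Continuous φ) : CcSubmodule →ₗ[ℂ] L2w φ where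
  toFun g := MemLp.toLp (fun z => (Real.exp (2 * φ z) : ℂ) * g.1 z)
    (memLp_of_continuous hφ ((by fun_prop : Continuous _).mul g.2.1) (g.2.2.mul_left))
  map_add' g k := by
    rw [← MemLp.toLp_add]
    congr 1
    ext z
    simp [mul_add]
  map_smul' c g := by
    rw [RingHom.id_apply, ← MemLp.toLp_const_smul]
    congr 1
    ext z
    simp [mul_left_comm]

lemma coe_expEmbed {φ : ℂ → ℝ} (hφ : Continuous φ) (g : CcSubmodule) :
    expEmbed hφ g =ᵐ[volume] fun z => (Real.exp (2 * φ z) : ℂ) * g.1 z := by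
  have := MemLp.coeFn_toLp (memLp_of_continuous hφ ((by fun_prop : Continuous
    fun z => (Real.exp (2 * φ z) : ℂ)).mul g.2.1) (g.2.2.mul_left))
  exact (volume_absolutelyContinuous hφ).ae_le this

lemma inner_expEmbed {φ : ℂ → ℝ} (hφ : Continuous φ) (u : L2w φ) (g : CcSubmodule) :
    ⟪u, expEmbed hφ g⟫_ℂ = ∫ z, conj (u z) * g.1 z := by
  rw [L2.inner_def, integral_weightedMeasure hφ]
  refine integral_congr_ae ?_
  filter_upwards [coe_expEmbed hφ g] with z hz
  rw [hz, RCLike.inner_apply]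
  have : (Real.exp (-2 * φ z) : ℂ) * (Real.exp (2 * φ z) : ℂ) = 1 := by
    rw [← Complex.ofReal_mul, ← Real.exp_add]; simp
  rw [Complex.real_smul]
  linear_combination (conj (u z) * g.1 z) * this

/-- Since `|e^{2φ} g|² e^{-2φ} = |g|² e^{2φ}`, the a priori estimate with weight `e^{2φ}` becomes an
inequality between norms in `L²_φ`. -/
lemma norm_sq_expEmbed {φ : ℂ → ℝ} (hφ : Continuous φ) (g : CcSubmodule) :
    ‖expEmbed hφ g‖ ^ 2 = ∫ z, ‖g.1 z‖ ^ 2 * Real.exp (2 * φ z) := by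
  have h := (inner_expEmbed hφ (expEmbed hφ g) g).symm.trans (inner_self_eq_norm_sq_to_K _)
  have h2 : ∫ z, conj (expEmbed hφ g z) * g.1 z =
      ((∫ z, ‖g.1 z‖ ^ 2 * Real.exp (2 * φ z) : ℝ) : ℂ) := by
    rw [← integral_complex_ofReal]
    refine integral_congr_ae ?_
    filter_upwards [coe_expEmbed hφ g] with z hz
    rw [hz, map_mul, Complex.conj_ofReal, mul_assoc, ← Complex.normSq_eq_conj_mul_self,
      Complex.normSq_eq_norm_sq]
    push_cast
    ring
  rw [h2] at h
  exact Complex.ofReal_injective (by rw [Complex.ofReal_pow]; exact h.symm)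

/-! ### The operators `α ↦ e^{2φ} α` and `α ↦ e^{2φ} ∂α` on test functions -/

lemma dbar_add {f g : ℂ → ℂ} (hf : Differentiable ℝ f) (hg : Differentiable ℝ g) :
    dbar (fun z => f z + g z) = fun z => dbar f z + dbar g z := by
  ext z
  simp only [dbar]
  rw [fderiv_fun_add (hf z) (hg z)]
  simp only [add_apply]
  ring

lemma dbar_const_mul {f : ℂ → ℂ} (c : ℂ) (hf : Differentiable ℝ f) :
    dbar (fun z => c * f z) = fun z => c * dbar f z := by
  ext z
  simp only [dbar]
  rw [fderiv_const_mul (hf z)]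
  simp only [smul_apply, smul_eq_mul]
  ring

lemma dbar_mul {f g : ℂ → ℂ} {z : ℂ} (hf : DifferentiableAt ℝ f z)
    (hg : DifferentiableAt ℝ g z) :
    dbar (fun z => f z * g z) z = dbar f z * g z + f z * dbar g z := by
  simp only [dbar]
  rw [fderiv_fun_mul hf hg]
  simp only [add_apply, smul_apply, smul_eq_mul]
  ring

lemma contDiff_conj {f : ℂ → ℂ} {n : WithTop ℕ∞} (hf : ContDiff ℝ n f) :
    ContDiff ℝ n fun z => conj (f z) :=
  Complex.conjCLE.contDiff.comp hf

lemma hasCompactSupport_conj {f : ℂ → ℂ} (hf : HasCompactSupport f) :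
    HasCompactSupport fun z => conj (f z) :=
  hf.comp_left (g := fun w => conj w) (map_zero _)

lemma contDiff_dbar {f : ℂ → ℂ} (hf : ContDiff ℝ ∞ f) : ContDiff ℝ ∞ (dbar f) := by
  have h : ContDiff ℝ ∞ (fderiv ℝ f) := hf.fderiv_right (by simp)
  exact contDiff_const.mul ((h.clm_apply contDiff_const).add
    (contDiff_const.mul (h.clm_apply contDiff_const)))

/-- The inclusion of test functions into `C_c`. -/
def testIncl : testSubmodule →ₗ[ℂ] CcSubmodule where
  toFun α := ⟨α.1, α.2.1.continuous, α.2.2⟩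
  map_add' _ _ := rfl
  map_smul' _ _ := rfl

/-- The operator `∂/∂z` on test functions, written as `conj ∘ ∂̄ ∘ conj`. -/
def testDel : testSubmodule →ₗ[ℂ] CcSubmodule where
  toFun α := ⟨fun z => conj (dbar (fun w => conj (α.1 w)) z),
    (contDiff_conj (contDiff_dbar (contDiff_conj α.2.1))).continuous,
    hasCompactSupport_conj (hasCompactSupport_dbar (hasCompactSupport_conj α.2.2))⟩
  map_add' α β := by
    have h := dbar_add ((contDiff_conj α.2.1).differentiable (by simp))
      ((contDiff_conj β.2.1).differentiable (by simp))
    ext z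
    simp only [Submodule.coe_add, Pi.add_apply, map_add] at h ⊢
    rw [h, map_add]
  map_smul' c α := by
    have h := dbar_const_mul (conj c) ((contDiff_conj α.2.1).differentiable (by simp))
    ext z
    simp only [Submodule.coe_smul, Pi.smul_apply, smul_eq_mul, map_mul, RingHom.id_apply] at h ⊢
    rw [h, map_mul, Complex.conj_conj]

/-- The weak `∂̄`-equation as an equation between inner products. -/
lemma hasWeakDbar_iff {φ : ℂ → ℝ} (hφ : Continuous φ) {u f : L2w φ} :
    HasWeakDbar u f ↔ ∀ α : testSubmodule,
      ⟪u, expEmbed hφ (testDel α)⟫_ℂ = -⟪f, expEmbed hφ (testIncl α)⟫_ℂ := by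
  -- The inner product is conjugate linear in its first entry, so `α` corresponds to the test
  -- function `conj α`; using `∂` in place of `∂̄` then gives the adjoint relation.
  have h1 : ∀ α : testSubmodule, ⟪u, expEmbed hφ (testDel α)⟫_ℂ =
      conj (∫ z, u z * dbar (fun w => conj (α.1 w)) z) := fun α => by
    rw [inner_expEmbed, ← integral_conj]
    simp [testDel]
  have h2 : ∀ α : testSubmodule, ⟪f, expEmbed hφ (testIncl α)⟫_ℂ =
      conj (∫ z, f z * conj (α.1 z)) := fun α => by
    rw [inner_expEmbed, ← integral_conj]
    simp [testIncl]
  constructor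
  · intro h α
    rw [h1, h2, h _ (contDiff_conj α.2.1) (hasCompactSupport_conj α.2.2), map_neg]
  · intro h ψ hψ hc
    have := h ⟨fun z => conj (ψ z), contDiff_conj hψ, hasCompactSupport_conj hc⟩
    rw [h1, h2, ← map_neg] at this
    simpa using (starRingEnd ℂ).injective this

/-! ### Solving the equation by duality -/

section Abstract

variable {H V : Type*} [NormedAddCommGroup H] [InnerProductSpace ℂ H] [AddCommGroup V] [Module ℂ V]

/-- The estimate makes `v α ↦ e α` well defined and bounded on the range of `v`, so it extends to a
bounded `B` on the closure. Minus the adjoint of `B` solves the equation and takes values in that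
closure. -/
lemma exists_dual_solution [CompleteSpace H] (v e : V →ₗ[ℂ] H) {C : ℝ} (h : ∀ α, ‖e α‖ ≤ C * ‖v α‖) :
    ∃ S : H →L[ℂ] H, ∀ f, (∀ α, ⟪S f, v α⟫_ℂ = -⟪f, e α⟫_ℂ) ∧
      S f ∈ (LinearMap.range v).topologicalClosure := by
  let K := (LinearMap.range v).topologicalClosure
  have hK : ∀ α, v α ∈ K := fun α => Submodule.le_topologicalClosure _ ⟨α, rfl⟩
  let v' : V →ₗ[ℂ] K := v.codRestrict K hK
  have hd : DenseRange v' := by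
    rw [Metric.denseRange_iff]
    intro x r hr
    obtain ⟨_, ⟨α, rfl⟩, hα⟩ := Metric.mem_closure_iff.1
      (show (x : H) ∈ closure (LinearMap.range v : Set H) from x.2) r hr
    exact ⟨α, hα⟩
  have hb : ∀ α, ‖e α‖ ≤ C * ‖v' α‖ := h
  have : CompleteSpace K := (Submodule.isClosed_topologicalClosure _).completeSpace_coe
  let B : K →L[ℂ] H := e.extendOfNorm v'
  refine ⟨-(K.subtypeL ∘L B.adjoint), fun f => ⟨fun α => ?_, ?_⟩⟩
  · have h1 : ⟪B.adjoint f, v' α⟫_ℂ = ⟪f, e α⟫_ℂ := by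
      rw [ContinuousLinearMap.adjoint_inner_left]
      congr 1
      exact LinearMap.extendOfNorm_eq hd ⟨C, hb⟩ α
    rw [← h1, neg_apply, inner_neg_left]
    rfl
  · exact K.neg_mem (B.adjoint f).2

/-- The bound passes to the closure by continuity, where `u` may be tested against itself. -/
lemma norm_le_of_mem_topologicalClosure {K : Submodule ℂ H} {u : H}
    (hu : u ∈ K.topologicalClosure) {D : ℝ} (hD : 0 ≤ D)
    (h : ∀ x ∈ K, ‖⟪u, x⟫_ℂ‖ ≤ D * ‖x‖) : ‖u‖ ≤ D := by
  have h1 : ∀ x ∈ K.topologicalClosure, ‖⟪u, x⟫_ℂ‖ ≤ D * ‖x‖ := by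
    intro x hx
    have hcl : IsClosed {x : H | ‖⟪u, x⟫_ℂ‖ ≤ D * ‖x‖} :=
      isClosed_le (by fun_prop) (by fun_prop)
    exact closure_minimal (fun x hx => h x hx) hcl hx
  have h2 := h1 u hu
  rcases eq_or_ne u 0 with rfl | hne
  · rwa [norm_zero]
  · rw [norm_inner_eq_norm_iff hne hne |>.2 ⟨1, one_ne_zero, by simp⟩] at h2
    exact le_of_mul_le_mul_right h2 (norm_pos_iff.2 hne)

end Abstract

/-! ### Cutting off by indicator functions in `L²`. -/

section IndicatorOperator

variable {X : Type*} [MeasurableSpace X] {μ : Measure X}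

/-- Multiplication by the indicator function of `s` on `L²`. -/
def indicatorL (μ : Measure X) {s : Set X} (hs : MeasurableSet s) : Lp ℂ 2 μ →L[ℂ] Lp ℂ 2 μ :=
  LinearMap.mkContinuous
    { toFun := fun f => ((Lp.memLp f).indicator hs).toLp
      map_add' := fun f g => by
        rw [← MemLp.toLp_add]
        refine MemLp.toLp_congr _ _ ?_
        filter_upwards [Lp.coeFn_add f g] with x hx
        by_cases h : x ∈ s
        · simp only [Pi.add_apply, Set.indicator_of_mem h, hx]
        · simp only [Pi.add_apply, Set.indicator_of_notMem h, add_zero]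
      map_smul' := fun c f => by
        rw [RingHom.id_apply, ← MemLp.toLp_const_smul]
        refine MemLp.toLp_congr _ _ ?_
        filter_upwards [Lp.coeFn_smul c f] with x hx
        by_cases h : x ∈ s
        · simp only [Pi.smul_apply, Set.indicator_of_mem h, hx]
        · simp only [Pi.smul_apply, Set.indicator_of_notMem h, smul_zero] } 1 fun f => by
    rw [one_mul]
    refine Lp.norm_le_norm_of_ae_le ?_
    filter_upwards [((Lp.memLp f).indicator hs).coeFn_toLp] with x hx
    rw [LinearMap.coe_mk, AddHom.coe_mk, hx]
    exact norm_indicator_le_norm_self _ _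

lemma coe_indicatorL {s : Set X} (hs : MeasurableSet s) (f : Lp ℂ 2 μ) :
    indicatorL μ hs f =ᵐ[μ] s.indicator f :=
  ((Lp.memLp f).indicator hs).coeFn_toLp

lemma norm_indicatorL_le {s : Set X} (hs : MeasurableSet s) (f : Lp ℂ 2 μ) :
    ‖indicatorL μ hs f‖ ≤ ‖f‖ := by
  refine Lp.norm_le_norm_of_ae_le ?_
  filter_upwards [coe_indicatorL hs f] with x hx
  rw [hx]
  exact norm_indicator_le_norm_self _ _

lemma inner_indicatorL {s : Set X} (hs : MeasurableSet s) (f g : Lp ℂ 2 μ) :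
    ⟪indicatorL μ hs f, g⟫_ℂ = ⟪indicatorL μ hs f, indicatorL μ hs g⟫_ℂ := by
  rw [L2.inner_def, L2.inner_def]
  refine integral_congr_ae ?_
  filter_upwards [coe_indicatorL hs f, coe_indicatorL hs g] with x hx hx'
  rw [hx, hx']
  by_cases h : x ∈ s <;> simp [h]

lemma indicatorL_compl {s : Set X} (hs : MeasurableSet s) (f : Lp ℂ 2 μ) :
    f - indicatorL μ hs f = indicatorL μ hs.compl f := by
  refine Lp.ext ?_
  filter_upwards [Lp.coeFn_sub f (indicatorL μ hs f), coe_indicatorL hs f,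
    coe_indicatorL hs.compl f] with x h1 h2 h3
  rw [h1, h3, Pi.sub_apply, h2]
  by_cases h : x ∈ s <;> simp [h]

end IndicatorOperator

/-! ### The a priori estimate in `L²_φ` and the solution operator. -/

section Estimate

variable {φ : ℂ → ℝ}

lemma norm_sq_L2w (hφ : Continuous φ) (u : L2w φ) :
    ‖u‖ ^ 2 = ∫ z, Real.exp (-2 * φ z) * ‖u z‖ ^ 2 := by
  have h := inner_self_eq_norm_sq_to_K (𝕜 := ℂ) u
  rw [L2.inner_def] at h
  have h2 : ∫ z, ⟪u z, u z⟫_ℂ ∂(weightedMeasure φ) =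
      ((∫ z, ‖u z‖ ^ 2 ∂(weightedMeasure φ) : ℝ) : ℂ) := by
    rw [← integral_complex_ofReal]
    refine integral_congr_ae (ae_of_all _ fun z => ?_)
    dsimp only
    rw [inner_self_eq_norm_sq_to_K, Complex.ofReal_pow]
    rfl
  rw [h2] at h
  have h3 : ‖u‖ ^ 2 = ∫ z, ‖u z‖ ^ 2 ∂(weightedMeasure φ) :=
    Complex.ofReal_injective (by rw [Complex.ofReal_pow]; exact h.symm)
  rw [h3, integral_weightedMeasure hφ]
  rfl

/-- The a priori estimate, localized to a set where the weight `τ` is at least `m`. -/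
lemma norm_indicatorL_expEmbed_le (hφ : Continuous φ) {τ : ℂ → ℝ} {C : ℝ} (hτc : Continuous τ)
    (hτ : ∀ z, 1 ≤ τ z)
    (hest : ∀ β : ℂ → ℂ, ContDiff ℝ ∞ β → HasCompactSupport β →
        ∫ z, τ z * ‖β z‖ ^ 2 * Real.exp (2 * φ z)
          ≤ C * ∫ z, ‖dbar β z‖ ^ 2 * Real.exp (2 * φ z))
    {s : Set ℂ} (hs : MeasurableSet s) {m : ℝ} (hm : 0 < m) (hms : ∀ z ∈ s, m ≤ τ z)
    (α : testSubmodule) :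
    ‖indicatorL (weightedMeasure φ) hs (expEmbed hφ (testIncl α))‖
      ≤ √(C / m) * ‖expEmbed hφ (testDel α)‖ := by
  have h1 := hest _ (contDiff_conj α.2.1) (hasCompactSupport_conj α.2.2)
  have h2 : ‖expEmbed hφ (testDel α)‖ ^ 2 =
      ∫ z, ‖dbar (fun w => conj (α.1 w)) z‖ ^ 2 * Real.exp (2 * φ z) := by
    rw [norm_sq_expEmbed]
    simp [testDel]
  simp only [RCLike.norm_conj] at h1
  rw [← h2] at h1
  have hαc : Continuous α.1 := α.2.1.continuous
  have hi : Integrable (fun z => m⁻¹ * (τ z * ‖α.1 z‖ ^ 2 * Real.exp (2 * φ z)))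
      (volume : Measure ℂ) :=
    integrable_of_eq_zero α.2.2 (by fun_prop) fun z hz => by simp [hz]
  have h3 : ‖indicatorL (weightedMeasure φ) hs (expEmbed hφ (testIncl α))‖ ^ 2 ≤
      ∫ z, m⁻¹ * (τ z * ‖α.1 z‖ ^ 2 * Real.exp (2 * φ z)) := by
    rw [norm_sq_L2w hφ]
    refine integral_mono_of_nonneg (ae_of_all _ fun z => by positivity) hi ?_
    have h4 := coe_indicatorL hs (expEmbed hφ (testIncl α))
    rw [ae_weightedMeasure hφ] at h4
    filter_upwards [h4, coe_expEmbed hφ (testIncl α)] with z hz hz'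
    rw [hz]
    by_cases h : z ∈ s
    · rw [Set.indicator_of_mem h, hz', norm_mul, mul_pow, Complex.norm_real,
        Real.norm_of_nonneg (Real.exp_nonneg _)]
      have e1 : Real.exp (-2 * φ z) * (Real.exp (2 * φ z) ^ 2 * ‖α.1 z‖ ^ 2) =
          ‖α.1 z‖ ^ 2 * Real.exp (2 * φ z) := by
        have : Real.exp (-2 * φ z) * Real.exp (2 * φ z) = 1 := by rw [← Real.exp_add]; simp
        linear_combination (Real.exp (2 * φ z) * ‖α.1 z‖ ^ 2) * this
      have e2 : 1 ≤ m⁻¹ * τ z := by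
        rw [inv_mul_eq_div, one_le_div hm]; exact hms z h
      calc _ = 1 * (‖α.1 z‖ ^ 2 * Real.exp (2 * φ z)) := by rw [one_mul]; exact e1
        _ ≤ (m⁻¹ * τ z) * (‖α.1 z‖ ^ 2 * Real.exp (2 * φ z)) := by gcongr
        _ = _ := by ring
    · rw [Set.indicator_of_notMem h]
      have := zero_lt_one.trans_le (hτ z)
      have h6 : 0 ≤ m⁻¹ * (τ z * ‖α.1 z‖ ^ 2 * Real.exp (2 * φ z)) := by positivity
      simpa using h6
  rw [integral_const_mul] at h3
  have h5 : ‖indicatorL (weightedMeasure φ) hs (expEmbed hφ (testIncl α))‖ ^ 2 ≤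
      (C / m) * ‖expEmbed hφ (testDel α)‖ ^ 2 := by
    refine h3.trans ?_
    calc _ ≤ m⁻¹ * (C * ‖expEmbed hφ (testDel α)‖ ^ 2) := by gcongr
      _ = _ := by ring
  rw [← Real.sqrt_sq (norm_nonneg (expEmbed hφ (testDel α))), ← Real.sqrt_mul' _ (sq_nonneg _)]
  exact Real.le_sqrt_of_sq_le h5

/-- The closure of the range of the formal adjoint of `∂̄`. -/
def rangeDel (hφ : Continuous φ) : Submodule ℂ (L2w φ) :=
  LinearMap.range (expEmbed hφ ∘ₗ testDel)

/-- Existence of solutions together with an estimate for data supported far out. -/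
lemma exists_solution_operator (hφ : ContDiff ℝ 2 φ)
    (hΔ : Tendsto (fun z : ℂ => (Δ φ) z) (cocompact ℂ) atTop) :
    ∃ S : L2w φ →L[ℂ] L2w φ,
      (∀ f, HasWeakDbar (S f) f ∧ S f ∈ (rangeDel hφ.continuous).topologicalClosure) ∧
      ∀ ε > 0, ∃ R : ℝ, ∀ f, ‖S (f - indicatorL (weightedMeasure φ)
        (measurableSet_closedBall (x := (0 : ℂ)) (ε := R)) f)‖ ≤ ε * ‖f‖ := by
  obtain ⟨τ, C, hC, hτc, hτ, hlim, hest⟩ := exists_weight hφ hΔ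
  have hφc := hφ.continuous
  have hglob : ∀ α : testSubmodule, ‖(expEmbed hφc ∘ₗ testIncl) α‖ ≤
      √(C / 1) * ‖(expEmbed hφc ∘ₗ testDel) α‖ := by
    intro α
    -- With the whole plane and `m = 1`, the localized estimate is the global one.
    have := norm_indicatorL_expEmbed_le hφc hτc hτ hest MeasurableSet.univ one_pos
      (fun z _ => hτ z) α
    rwa [show indicatorL (weightedMeasure φ) MeasurableSet.univ (expEmbed hφc (testIncl α)) =
      (expEmbed hφc ∘ₗ testIncl) α from ?_] at this
    refine Lp.ext ((coe_indicatorL _ _).trans ?_)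
    simp
  obtain ⟨S, hS⟩ := exists_dual_solution (expEmbed hφc ∘ₗ testDel) (expEmbed hφc ∘ₗ testIncl) hglob
  refine ⟨S, fun f => ⟨(hasWeakDbar_iff hφc).2 (hS f).1, (hS f).2⟩, fun ε hε => ?_⟩
  -- `m = C / ε²` makes the localized constant exactly `ε`; then `R` is a radius beyond which `τ ≥
  -- m`.
  obtain ⟨m, hm, hmε⟩ : ∃ m : ℝ, 0 < m ∧ √(C / m) ≤ ε :=
    ⟨C / ε ^ 2, by positivity, by
      rw [div_div_cancel₀ hC.ne', Real.sqrt_sq hε.le]⟩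
  have hev := hlim.eventually (eventually_ge_atTop m)
  rw [← Metric.cobounded_eq_cocompact, ← comap_norm_atTop, eventually_comap,
    eventually_atTop] at hev
  obtain ⟨R, hR⟩ := hev
  refine ⟨R, fun f => ?_⟩
  rw [indicatorL_compl]
  have hms : ∀ z ∈ (Metric.closedBall (0 : ℂ) R)ᶜ, m ≤ τ z := fun z hz => by
    rw [Set.mem_compl_iff, mem_closedBall_zero_iff, not_le] at hz
    exact hR ‖z‖ hz.le z rfl
  -- The solution is tested only against the range. There it pairs as the data does, and the data
  -- sees only the part outside the disc, where the estimate has constant `ε`.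
  refine norm_le_of_mem_topologicalClosure (hS _).2 (by positivity) ?_
  rintro _ ⟨α, rfl⟩
  rw [(hS _).1 α, norm_neg, inner_indicatorL]
  calc _ ≤ _ := norm_inner_le_norm _ _
    _ ≤ ‖f‖ * (ε * ‖expEmbed hφc (testDel α)‖) := by
        refine mul_le_mul (norm_indicatorL_le _ _) ?_ (norm_nonneg _) (norm_nonneg _)
        exact (norm_indicatorL_expEmbed_le hφc hτc hτ hest _ hm hms α).trans (by gcongr)
    _ = _ := by rw [LinearMap.comp_apply]; ring

end Estimate

/-! ### The Cauchy kernel -/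

lemma integrable_planeKernel :
    Integrable (fun z : ℂ => ((1 + ‖z‖ ^ 2) ^ 2)⁻¹) (volume : Measure ℂ) := by
  have h := integrable_rpow_neg_one_add_norm_sq (E := ℂ) (μ := volume) (r := 4)
    (by rw [Complex.finrank_real_complex]; norm_num)
  refine h.congr (ae_of_all _ fun z => ?_)
  dsimp only
  rw [show (-4 / 2 : ℝ) = -((2 : ℕ) : ℝ) by norm_num, Real.rpow_neg (by positivity),
    Real.rpow_natCast]

/-- The total mass of `(1 + |z|²)⁻²`. -/
def kappa : ℝ := ∫ z : ℂ, ((1 + ‖z‖ ^ 2) ^ 2)⁻¹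

/-- Only nonvanishing matters, since the parametrix is normalized by dividing by `kappa`; its value
`π` plays no role. -/
lemma kappa_pos : 0 < kappa := by
  refine (integral_pos_iff_support_of_nonneg (fun z => by positivity) integrable_planeKernel).2 ?_
  have : Function.support (fun z : ℂ => ((1 + ‖z‖ ^ 2) ^ 2)⁻¹) = Set.univ := by
    ext z
    simp only [Function.mem_support, Set.mem_univ, iff_true]
    positivity
  rw [this]
  simp

lemma locallyIntegrable_inv : LocallyIntegrable (fun z : ℂ => z⁻¹) (volume : Measure ℂ) := by
  refine locallyIntegrable_of_norm_le_rpow (C := 1) (α := 1) ?_ ?_ (ae_of_all _ fun z => ?_) ?_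
  · rw [Complex.finrank_real_complex]; norm_num
  · rw [Complex.finrank_real_complex]; norm_num
  · rw [one_mul, Real.rpow_neg_one, norm_inv]
  · exact measurable_inv.aestronglyMeasurable

lemma integral_dbar_eq_zero {g : ℂ → ℂ} (hg : ContDiff ℝ 1 g) (hc : HasCompactSupport g) :
    ∫ z, dbar g z = 0 := by
  have hi : ∀ v : ℂ, Integrable (fun z => fderiv ℝ g z v) (volume : Measure ℂ) := fun v =>
    Continuous.integrable_of_hasCompactSupport
      ((hg.continuous_fderiv one_ne_zero).clm_apply continuous_const)
      ((hc.fderiv ℝ).comp_left (g := fun L : ℂ →L[ℝ] ℂ => L v) rfl)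
  simp only [dbar]
  rw [integral_const_mul, integral_add (hi 1) ((hi Complex.I).const_mul _), integral_const_mul,
    integral_fderiv_eq_zero hg hc, integral_fderiv_eq_zero hg hc]
  simp

/-- A smooth approximation of the Cauchy kernel. -/
def cauchyReg (t : ℝ) (z : ℂ) : ℂ := conj z / (z * conj z + (t : ℂ) ^ 2)

lemma cauchyReg_denom (t : ℝ) (z : ℂ) :
    z * conj z + (t : ℂ) ^ 2 = ((‖z‖ ^ 2 + t ^ 2 : ℝ) : ℂ) := by
  rw [Complex.mul_conj, Complex.normSq_eq_norm_sq]; push_cast; ring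

lemma cauchyReg_denom_ne {t : ℝ} (ht : 0 < t) (z : ℂ) : z * conj z + (t : ℂ) ^ 2 ≠ 0 := by
  rw [cauchyReg_denom, Complex.ofReal_ne_zero]; positivity

lemma contDiff_cauchyReg {t : ℝ} (ht : 0 < t) : ContDiff ℝ 1 (cauchyReg t) := by
  have hc : ContDiff ℝ 1 fun w : ℂ => conj w := contDiff_conj contDiff_id
  have hD : ContDiff ℝ 1 fun w : ℂ => w * conj w + (t : ℂ) ^ 2 :=
    (contDiff_id.mul hc).add contDiff_const
  have h : ContDiff ℝ 1 fun z : ℂ => conj z * (z * conj z + (t : ℂ) ^ 2)⁻¹ :=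
    hc.mul (hD.inv (cauchyReg_denom_ne ht))
  simp only [← div_eq_mul_inv] at h
  exact h

lemma dbar_conj (z : ℂ) : dbar (fun w => conj w) z = 1 := by
  have : fderiv ℝ (fun w : ℂ => conj w) z = (Complex.conjCLE : ℂ →L[ℝ] ℂ) :=
    Complex.conjCLE.hasFDerivAt.fderiv
  rw [dbar, this]
  simp
  norm_num

lemma dbar_eq_zero_of_differentiableAt {g : ℂ → ℂ} {z : ℂ} (hg : DifferentiableAt ℂ g z) :
    dbar g z = 0 := by
  have h := (hg.hasFDerivAt.restrictScalars ℝ).fderiv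
  rw [dbar, h]
  have : (fderiv ℂ g z) Complex.I = Complex.I * (fderiv ℂ g z) 1 := by
    rw [← smul_eq_mul, ← map_smul]; simp
  simp only [ContinuousLinearMap.coe_restrictScalars', this]
  rw [← mul_assoc, Complex.I_mul_I]
  ring

/-- Apply the product rule to `cauchyReg t z * (|z|² + t²) = conj z`. The result is an approximate
identity, a rescaling of `(1 + |z|²)⁻²` of mass `kappa` for every `t`. -/
lemma dbar_cauchyReg {t : ℝ} (ht : 0 < t) (z : ℂ) :
    dbar (cauchyReg t) z = ((t ^ 2 / (‖z‖ ^ 2 + t ^ 2) ^ 2 : ℝ) : ℂ) := by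
  have hc : Differentiable ℝ fun w : ℂ => conj w := Complex.conjCLE.differentiable
  have hk := (contDiff_cauchyReg ht).differentiable one_ne_zero
  have hD : Differentiable ℝ fun w : ℂ => w * conj w := differentiable_id.mul hc
  have h1 : (fun w => cauchyReg t w * (w * conj w + (t : ℂ) ^ 2)) = fun w => conj w := by
    ext w
    exact div_mul_cancel₀ _ (cauchyReg_denom_ne ht w)
  have h2 : dbar (fun w : ℂ => w * conj w + (t : ℂ) ^ 2) z = z := by
    rw [dbar_add hD (differentiable_const _)]
    dsimp only
    rw [dbar_mul differentiableAt_fun_id (hc z), dbar_conj,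
      dbar_eq_zero_of_differentiableAt (differentiableAt_const _),
      show dbar (fun w : ℂ => w) z = 0 from dbar_eq_zero_of_differentiableAt differentiableAt_id]
    simp
  have h3 := dbar_mul (hk z) ((hD.add_const _) z : DifferentiableAt ℝ
    (fun w : ℂ => w * conj w + (t : ℂ) ^ 2) z)
  rw [h1, h2, dbar_conj] at h3
  have hne := cauchyReg_denom_ne ht z
  have h4 : dbar (cauchyReg t) z = (t : ℂ) ^ 2 / (z * conj z + (t : ℂ) ^ 2) ^ 2 := by
    rw [eq_div_iff (pow_ne_zero 2 hne)]
    have h5 : cauchyReg t z * (z * conj z + (t : ℂ) ^ 2) = conj z := congrFun h1 z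
    linear_combination -(z * conj z + (t : ℂ) ^ 2) * h3 - z * h5
  rw [h4, cauchyReg_denom]
  push_cast
  rfl

lemma norm_cauchyReg_le {t : ℝ} (ht : 0 < t) (z : ℂ) : ‖cauchyReg t z‖ ≤ ‖z⁻¹‖ := by
  rcases eq_or_ne z 0 with rfl | hz
  · simp [cauchyReg]
  have hz' := norm_pos_iff.2 hz
  rw [cauchyReg, cauchyReg_denom, norm_div, Complex.norm_real, RCLike.norm_conj, norm_inv,
    Real.norm_of_nonneg (by positivity), ← one_div, div_le_div_iff₀ (by positivity) hz']
  nlinarith [sq_nonneg t]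

lemma tendsto_cauchyReg {z : ℂ} (hz : z ≠ 0) :
    Tendsto (fun t : ℝ => cauchyReg t z) (𝓝[>] 0) (𝓝 z⁻¹) := by
  have hne : z * conj z + ((0 : ℝ) : ℂ) ^ 2 ≠ 0 := by simpa using hz
  have h : ContinuousAt (fun t : ℝ => cauchyReg t z) 0 :=
    continuousAt_const.div (by fun_prop) hne
  have h2 : cauchyReg 0 z = z⁻¹ := by
    have : conj z ≠ 0 := by simpa using hz
    simp only [cauchyReg, Complex.ofReal_zero]
    field_simp
    simp
  rw [← h2]
  exact h.tendsto.mono_left nhdsWithin_le_nhds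

/-- The Cauchy–Pompeiu formula for compactly supported functions. -/
lemma integral_dbar_mul_inv {g : ℂ → ℂ} (hg : ContDiff ℝ 1 g) (hc : HasCompactSupport g) :
    ∫ z, dbar g z * z⁻¹ = -(kappa * g 0) := by
  have hgd := hg.differentiable one_ne_zero
  have hdc := continuous_dbar hg
  have hds := hasCompactSupport_dbar hc
  -- The integral of `∂̄(g * cauchyReg t)` vanishes; the substitution `z = t η` then makes the
  -- approximate identity independent of `t`.
  have key : ∀ t : ℝ, 0 < t → ∫ z, dbar g z * cauchyReg t z =
      -∫ η : ℂ, g (t • η) * ((((1 + ‖η‖ ^ 2) ^ 2)⁻¹ : ℝ) : ℂ) := by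
    intro t ht
    have hk := contDiff_cauchyReg ht
    have h0 := integral_dbar_eq_zero (hg.mul hk) hc.mul_right
    have h1 : (fun z => dbar (fun w => g w * cauchyReg t w) z) =
        fun z => dbar g z * cauchyReg t z + g z * dbar (cauchyReg t) z := by
      ext z
      exact dbar_mul (hgd z) (hk.differentiable one_ne_zero z)
    have h0' : ∫ z, dbar (fun w => g w * cauchyReg t w) z = 0 := h0
    have i1 : Integrable (fun z => dbar g z * cauchyReg t z) (volume : Measure ℂ) :=
      (hdc.mul hk.continuous).integrable_of_hasCompactSupport hds.mul_right
    have i2 : Integrable (fun z => g z * dbar (cauchyReg t) z) (volume : Measure ℂ) :=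
      (hg.continuous.mul (continuous_dbar hk)).integrable_of_hasCompactSupport hc.mul_right
    rw [h1, integral_add i1 i2] at h0'
    rw [eq_neg_of_add_eq_zero_left h0', neg_inj]
    have h2 := Measure.integral_comp_smul (volume : Measure ℂ)
      (fun z => g z * dbar (cauchyReg t) z) t
    rw [Complex.finrank_real_complex, abs_of_pos (by positivity)] at h2
    have h3 : ∫ z, g z * dbar (cauchyReg t) z =
        (t ^ 2 : ℝ) • ∫ z, g (t • z) * dbar (cauchyReg t) (t • z) := by
      rw [h2, smul_smul, mul_inv_cancel₀ (by positivity), one_smul]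
    rw [h3, ← integral_smul]
    refine integral_congr_ae (ae_of_all _ fun η => ?_)
    dsimp only
    rw [dbar_cauchyReg ht, norm_smul, Real.norm_of_nonneg ht.le, Complex.real_smul,
      mul_left_comm, ← Complex.ofReal_mul]
    congr 2
    field_simp
    ring
  have hL : Tendsto (fun t : ℝ => ∫ z, dbar g z * cauchyReg t z) (𝓝[>] 0)
      (𝓝 (∫ z, dbar g z * z⁻¹)) := by
    refine tendsto_integral_filter_of_dominated_convergence (fun z => ‖dbar g z * z⁻¹‖) ?_ ?_ ?_ ?_
    · filter_upwards [self_mem_nhdsWithin] with t ht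
      exact (hdc.mul (contDiff_cauchyReg ht).continuous).aestronglyMeasurable
    · filter_upwards [self_mem_nhdsWithin] with t ht
      refine ae_of_all _ fun z => ?_
      rw [norm_mul, norm_mul]
      gcongr
      exact norm_cauchyReg_le ht z
    · exact (locallyIntegrable_inv.integrable_smul_left_of_hasCompactSupport hdc hds).norm
    · filter_upwards [Measure.ae_ne (volume : Measure ℂ) 0] with z hz
      exact (tendsto_cauchyReg hz).const_mul _
  have hR : Tendsto (fun t : ℝ => -∫ η : ℂ, g (t • η) * ((((1 + ‖η‖ ^ 2) ^ 2)⁻¹ : ℝ) : ℂ))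
      (𝓝[>] 0) (𝓝 (-∫ η : ℂ, g 0 * ((((1 + ‖η‖ ^ 2) ^ 2)⁻¹ : ℝ) : ℂ))) := by
    obtain ⟨M, hM⟩ := hc.exists_bound_of_continuous hg.continuous
    refine (tendsto_integral_filter_of_dominated_convergence
      (fun η => M * ((1 + ‖η‖ ^ 2) ^ 2)⁻¹) ?_ ?_ ?_ ?_).neg
    · refine Eventually.of_forall fun t => ?_
      have := integrable_planeKernel.ofReal (𝕜 := ℂ) |>.aestronglyMeasurable
      exact ((hg.continuous.comp (continuous_const_smul t)).aestronglyMeasurable).mul this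
    · refine Eventually.of_forall fun t => ae_of_all _ fun η => ?_
      rw [norm_mul, Complex.norm_real, Real.norm_of_nonneg (by positivity)]
      gcongr
      exact hM _
    · exact integrable_planeKernel.const_mul M
    · refine ae_of_all _ fun η => Tendsto.mul_const _ ?_
      have : ContinuousAt (fun t : ℝ => g (t • η)) 0 := by
        have := hg.continuous
        fun_prop
      have h := this.tendsto
      rw [zero_smul] at h
      exact h.mono_left nhdsWithin_le_nhds
  have hfin := tendsto_nhds_unique hL (hR.congr' (by
    filter_upwards [self_mem_nhdsWithin] with t ht using (key t ht).symm))
  rw [hfin, integral_const_mul, integral_complex_ofReal, mul_comm]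
  rfl

/-- `k` and `η` are supported in the disc of radius two and `∂̄ k = δ₀ + η`, with `k` integrable
and `η` smooth. -/
structure IsParametrix (k η : ℂ → ℂ) : Prop where
  integrable : Integrable k (volume : Measure ℂ)
  eq_zero : ∀ z, 2 < ‖z‖ → k z = 0
  contDiff_remainder : ContDiff ℝ ∞ η
  remainder_eq_zero : ∀ z, 2 < ‖z‖ → η z = 0
  integral_dbar_mul : ∀ ψ : ℂ → ℂ, ContDiff ℝ 1 ψ → ∀ w,
    ∫ z, dbar ψ (w + z) * k z = -ψ w - ∫ z, ψ (w + z) * η z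

/-- Truncating the Cauchy kernel gives a parametrix for `∂̄`. -/
lemma exists_parametrix : ∃ k η : ℂ → ℂ, IsParametrix k η := by
  have hκ : (kappa : ℂ) ≠ 0 := Complex.ofReal_ne_zero.2 kappa_pos.ne'
  let b : ContDiffBump (0 : ℂ) := ⟨1, 2, one_pos, by norm_num⟩
  obtain ⟨χ, hχ⟩ : ∃ χ : ℂ → ℂ, χ = fun z => ((b z : ℝ) : ℂ) := ⟨_, rfl⟩
  have hχd : ContDiff ℝ ∞ χ := by rw [hχ]; exact Complex.ofRealCLM.contDiff.comp b.contDiff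
  have hχ1 : ContDiff ℝ 1 χ := by exact_mod_cast contDiff_infty.1 hχd 1
  have hχs : HasCompactSupport χ := by
    rw [hχ]; exact b.hasCompactSupport.comp_left (g := fun x : ℝ => (x : ℂ)) rfl
  have hχ0 : χ 0 = 1 := by
    rw [hχ]
    simp [b.one_of_mem_closedBall (Metric.mem_closedBall_self zero_le_one)]
  have hχout : ∀ z, 2 < ‖z‖ → χ =ᶠ[𝓝 z] fun _ => 0 := fun z hz => by
    filter_upwards [continuous_norm.continuousAt.eventually (lt_mem_nhds hz)] with w hw
    rw [hχ]
    simp [b.zero_of_le_dist (x := w) (by rw [dist_zero_right]; exact hw.le)]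
  have hdout : ∀ z, 2 < ‖z‖ → dbar χ z = 0 := fun z hz => by
    rw [dbar, (hχout z hz).fderiv_eq]
    simp
  have hdin : ∀ z ∈ Metric.ball (0 : ℂ) 1, dbar χ z = 0 := fun z hz => by
    have : χ =ᶠ[𝓝 z] fun _ => 1 := by
      filter_upwards [Metric.isOpen_ball.mem_nhds hz] with w hw
      rw [hχ]
      simp [b.one_of_mem_closedBall (Metric.ball_subset_closedBall hw)]
    rw [dbar, this.fderiv_eq]
    simp
  have hik : Integrable (fun z => χ z * z⁻¹) (volume : Measure ℂ) :=
    locallyIntegrable_inv.integrable_smul_left_of_hasCompactSupport hχd.continuous hχs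
  refine ⟨fun z => (kappa : ℂ)⁻¹ * (χ z * z⁻¹), fun z => (kappa : ℂ)⁻¹ * (dbar χ z * z⁻¹),
    hik.const_mul _, fun z hz => by simp [(hχout z hz).self_of_nhds],
    contDiff_const.mul (contDiff_iff_contDiffAt.2 fun z => ?_),
    fun z hz => by simp [hdout z hz], fun ψ hψ w => ?_⟩
  -- The singularity of `z⁻¹` does no harm: `∂̄χ` vanishes on the unit disc, where `χ` is constant.
  · rcases eq_or_ne z 0 with rfl | hz
    · refine (contDiffAt_const (c := (0 : ℂ))).congr_of_eventuallyEq ?_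
      filter_upwards [Metric.ball_mem_nhds (0 : ℂ) one_pos] with z hz
      rw [hdin z hz, zero_mul]
    · exact (contDiff_dbar hχd).contDiffAt.mul (contDiffAt_id.inv hz)
  · have hψw : ContDiff ℝ 1 fun z => ψ (w + z) := hψ.comp (contDiff_const.add contDiff_id)
    have hdw : ∀ z, dbar (fun z => ψ (w + z)) z = dbar ψ (w + z) := fun z => by
      simp only [dbar]
      rw [fderiv_comp_add_left]
    -- Cauchy–Pompeiu for `ψ(w + ·) χ`: the product rule separates the kernel term from the
    -- remainder term.
    have h1 := integral_dbar_mul_inv (hψw.mul hχ1) hχs.mul_left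
    have h2 : ∀ z, dbar (fun z => ψ (w + z) * χ z) z * z⁻¹ =
        dbar ψ (w + z) * (χ z * z⁻¹) + ψ (w + z) * (dbar χ z * z⁻¹) := fun z => by
      rw [dbar_mul (hψw.differentiable one_ne_zero z) (hχ1.differentiable one_ne_zero z), hdw]
      ring
    have i1 : Integrable (fun z => dbar ψ (w + z) * (χ z * z⁻¹)) (volume : Measure ℂ) := by
      have hc : Continuous fun z => dbar ψ (w + z) * χ z :=
        ((continuous_dbar hψ).comp (continuous_const.add continuous_id)).mul hχ1.continuous
      have := locallyIntegrable_inv.integrable_smul_left_of_hasCompactSupport hc hχs.mul_left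
      simpa [mul_assoc] using this
    have i2 : Integrable (fun z => ψ (w + z) * (dbar χ z * z⁻¹)) (volume : Measure ℂ) := by
      have hc : Continuous fun z => ψ (w + z) * dbar χ z :=
        hψw.continuous.mul (continuous_dbar hχ1)
      have := locallyIntegrable_inv.integrable_smul_left_of_hasCompactSupport hc
        (hasCompactSupport_dbar hχs).mul_left
      simpa [mul_assoc] using this
    have h3 : ∫ z, dbar (fun z => ψ (w + z) * χ z) z * z⁻¹ = -(kappa * (ψ (w + 0) * χ 0)) := h1
    simp only [h2] at h3
    rw [integral_add i1 i2, add_zero, hχ0, mul_one] at h3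
    simp only [mul_left_comm _ (kappa : ℂ)⁻¹]
    rw [integral_const_mul, integral_const_mul]
    have h4 : (kappa : ℂ)⁻¹ * kappa = 1 := inv_mul_cancel₀ hκ
    linear_combination (kappa : ℂ)⁻¹ * h3 - ψ w * h4

/-! ### Convolution, the parametrix and Weyl's lemma -/

/-- Convolution of complex functions on the plane. -/
abbrev conv (f g : ℂ → ℂ) : ℂ → ℂ := f ⋆[ContinuousLinearMap.mul ℝ ℂ, volume] g

lemma conv_apply (f g : ℂ → ℂ) (z : ℂ) : conv f g z = ∫ t, f t * g (z - t) := rfl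

lemma hasCompactSupport_of_eq_zero {f : ℂ → ℂ} {r : ℝ} (h : ∀ z, r < ‖z‖ → f z = 0) :
    HasCompactSupport f :=
  HasCompactSupport.intro (isCompact_closedBall (0 : ℂ) r) fun z hz => h z (by simpa using hz)

lemma dbar_conv {f g : ℂ → ℂ} (hf : LocallyIntegrable f (volume : Measure ℂ))
    (hg : ContDiff ℝ 1 g) (hc : HasCompactSupport g) (z : ℂ) :
    dbar (conv f g) z = conv f (dbar g) z := by
  have h := (hc.hasFDerivAt_convolution_right (ContinuousLinearMap.mul ℝ ℂ) hf hg z).fderiv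
  have hcf := hg.continuous_fderiv one_ne_zero
  have hi : ∀ v : ℂ, Integrable (fun t => f t * fderiv ℝ g (z - t) v) (volume : Measure ℂ) := by
    intro v
    have hv : HasCompactSupport fun w => fderiv ℝ g w v :=
      (hc.fderiv ℝ).comp_left (g := fun L : ℂ →L[ℝ] ℂ => L v) rfl
    exact hv.convolutionExists_right (ContinuousLinearMap.mul ℝ ℂ) hf
      (hcf.clm_apply continuous_const) z
  have hv : ∀ v, fderiv ℝ (conv f g) z v = ∫ t, f t * fderiv ℝ g (z - t) v := fun v => by
    rw [h, convolution_precompR_apply _ hf (hc.fderiv ℝ) hcf]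
    rfl
  rw [dbar, hv, hv, conv_apply, ← integral_const_mul, ← integral_add (hi 1) ((hi _).const_mul _),
    ← integral_const_mul]
  refine integral_congr_ae (ae_of_all _ fun t => ?_)
  simp only [dbar]
  ring

section Fubini

variable {g k B : ℂ → ℂ} {M : ℝ}

lemma integrable_prod_conv (hg : Integrable g (volume : Measure ℂ))
    (hk : Integrable k (volume : Measure ℂ)) (hB : Continuous B) (hM : ∀ z, ‖B z‖ ≤ M) :
    Integrable (fun p : ℂ × ℂ => B p.1 * (g p.2 * k (p.1 - p.2)))
      ((volume : Measure ℂ).prod volume) :=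
  (hg.convolution_integrand (ContinuousLinearMap.mul ℝ ℂ) hk).bdd_mul
    (hB.comp continuous_fst).aestronglyMeasurable (ae_of_all _ fun p => hM p.1)

lemma integral_mul_conv_integrand (w : ℂ) :
    ∫ z, B z * (g w * k (z - w)) = g w * ∫ z, B (w + z) * k z := by
  rw [← integral_const_mul, ← integral_add_left_eq_self _ w]
  refine integral_congr_ae (ae_of_all _ fun z => ?_)
  dsimp only
  rw [add_sub_cancel_left]
  ring

lemma integrable_mul_integral (hg : Integrable g (volume : Measure ℂ))
    (hk : Integrable k (volume : Measure ℂ)) (hB : Continuous B) (hM : ∀ z, ‖B z‖ ≤ M) :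
    Integrable (fun w => g w * ∫ z, B (w + z) * k z) (volume : Measure ℂ) :=
  (integrable_prod_conv hg hk hB hM).integral_prod_right.congr
    (ae_of_all _ fun w => integral_mul_conv_integrand w)

/-- Fubini and a translation move the kernel onto `B`, in the form in which the parametrix identity
is stated. -/
lemma integral_conv_mul (hg : Integrable g (volume : Measure ℂ))
    (hk : Integrable k (volume : Measure ℂ)) (hB : Continuous B) (hM : ∀ z, ‖B z‖ ≤ M) :
    ∫ z, conv g k z * B z = ∫ w, g w * ∫ z, B (w + z) * k z := by
  calc ∫ z, conv g k z * B z = ∫ z, ∫ w, B z * (g w * k (z - w)) := by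
        refine integral_congr_ae (ae_of_all _ fun z => ?_)
        dsimp only
        rw [conv_apply, mul_comm, integral_const_mul]
    _ = ∫ w, ∫ z, B z * (g w * k (z - w)) :=
        integral_integral_swap (integrable_prod_conv hg hk hB hM)
    _ = _ := integral_congr_ae (ae_of_all _ fun w => integral_mul_conv_integrand w)

end Fubini

namespace IsParametrix

variable {k η : ℂ → ℂ}

lemma hasCompactSupport_remainder (hp : IsParametrix k η) : HasCompactSupport η :=
  hasCompactSupport_of_eq_zero hp.remainder_eq_zero

lemma integrable_remainder (hp : IsParametrix k η) : Integrable η (volume : Measure ℂ) :=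
  hp.contDiff_remainder.continuous.integrable_of_hasCompactSupport hp.hasCompactSupport_remainder

/-- The parametrix solves the weak `∂̄`-equation up to a smoothing error. -/
lemma hasWeakDbar_conv (hp : IsParametrix k η) {g : ℂ → ℂ}
    (hg : Integrable g (volume : Measure ℂ)) :
    HasWeakDbar (conv g k) (fun z => g z + conv g η z) := by
  intro ψ hψ hc
  have hψ1 : ContDiff ℝ 1 ψ := by exact_mod_cast contDiff_infty.1 hψ 1
  have hdc := continuous_dbar hψ1
  obtain ⟨M, hM⟩ := (hasCompactSupport_dbar hc).exists_bound_of_continuous hdc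
  obtain ⟨M', hM'⟩ := hc.exists_bound_of_continuous hψ.continuous
  have i1 : Integrable (fun w => ψ w * g w) (volume : Measure ℂ) :=
    hg.bdd_mul hψ.continuous.aestronglyMeasurable (ae_of_all _ hM')
  have i2 : Integrable (fun w => ψ w * conv g η w) (volume : Measure ℂ) :=
    (hg.integrable_convolution _ hp.integrable_remainder).bdd_mul
      hψ.continuous.aestronglyMeasurable (ae_of_all _ hM')
  have i3 : Integrable (fun w => g w * ∫ z, ψ (w + z) * η z) (volume : Measure ℂ) :=
    integrable_mul_integral hg hp.integrable_remainder hψ.continuous hM'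
  rw [integral_conv_mul hg hp.integrable hdc hM]
  simp only [hp.integral_dbar_mul ψ hψ1]
  have e1 : ∀ w, g w * (-ψ w - ∫ z, ψ (w + z) * η z) =
      -(ψ w * g w) - g w * ∫ z, ψ (w + z) * η z := fun w => by ring
  have e2 : ∀ w, (g w + conv g η w) * ψ w = ψ w * g w + ψ w * conv g η w := fun w => by ring
  simp only [e1, e2]
  rw [integral_sub (f := fun w => -(ψ w * g w)) i1.neg i3, integral_neg, integral_add i1 i2,
    ← integral_conv_mul hg hp.integrable_remainder hψ.continuous hM']
  simp only [mul_comm (ψ _)]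
  ring

/-- The factor in parentheses is `∂̄` of the convolution of `k(-·)` with `ψ`. That convolution is
itself a test function, because `k` is integrable with compact support. -/
lemma integral_mul_sub_eq_zero (hp : IsParametrix k η) {h : ℂ → ℂ} (hw : HasWeakDbar h 0)
    {ψ : ℂ → ℂ} (hψ : ContDiff ℝ ∞ ψ) (hc : HasCompactSupport ψ) :
    ∫ w, h w * (-ψ w - ∫ z, ψ (w + z) * η z) = 0 := by
  have hψ1 : ContDiff ℝ 1 ψ := by exact_mod_cast contDiff_infty.1 hψ 1
  have hki : Integrable (fun z => k (-z)) (volume : Measure ℂ) := hp.integrable.comp_neg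
  have hks : HasCompactSupport fun z => k (-z) :=
    hasCompactSupport_of_eq_zero (r := 2) fun z hz => hp.eq_zero _ (by rwa [norm_neg])
  have hΦ : ContDiff ℝ ∞ (conv (fun z => k (-z)) ψ) :=
    hc.contDiff_convolution_right (n := ⊤) _ hki.locallyIntegrable hψ
  have hΦs : HasCompactSupport (conv (fun z => k (-z)) ψ) := hks.convolution _ hc
  have hdΦ : ∀ w, dbar (conv (fun z => k (-z)) ψ) w = -ψ w - ∫ z, ψ (w + z) * η z := fun w => by
    rw [dbar_conv hki.locallyIntegrable hψ1 hc, ← hp.integral_dbar_mul ψ hψ1, conv_apply,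
      ← integral_neg_eq_self (fun t => k (-t) * dbar ψ (w - t))]
    refine integral_congr_ae (ae_of_all _ fun z => ?_)
    dsimp only
    rw [neg_neg, sub_neg_eq_add, mul_comm]
  have h1 := hw _ hΦ hΦs
  simpa only [hdΦ, Pi.zero_apply, zero_mul, integral_zero, neg_zero] using h1

/-- Testing a weakly holomorphic function against the parametrix. -/
lemma integral_eq_of_hasWeakDbar_zero (hp : IsParametrix k η) {h : ℂ → ℂ}
    (hh : LocallyIntegrable h (volume : Measure ℂ)) (hw : HasWeakDbar h 0) {ψ : ℂ → ℂ}
    (hψ : ContDiff ℝ ∞ ψ) (hc : HasCompactSupport ψ) :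
    ∫ z, h z * ψ z = - ∫ z, conv h η z * ψ z := by
  have h1 := hp.integral_mul_sub_eq_zero hw hψ hc
  have i1 : Integrable (fun z => h z * ψ z) (volume : Measure ℂ) :=
    hh.integrable_smul_right_of_hasCompactSupport hψ.continuous hc
  obtain ⟨M, hM⟩ := hc.exists_bound_of_continuous hψ.continuous
  obtain ⟨ρ, hρ⟩ : ∃ ρ : ℝ, ∀ z, ρ < ‖z‖ → ψ z = 0 := by
    obtain ⟨ρ, hρ⟩ := hc.isBounded.subset_closedBall (0 : ℂ)
    refine ⟨ρ, fun z hz => image_eq_zero_of_notMem_tsupport fun hmem => ?_⟩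
    have := hρ hmem
    rw [mem_closedBall_zero_iff] at this
    linarith
  -- Fubini needs an integrable function. As `ψ` lives in radius `ρ` and `η` in radius `2`, cutting
  -- `h` at radius `ρ + 2` changes none of the integrals with `η`.
  obtain ⟨g, hg⟩ : ∃ g, g = (Metric.closedBall (0 : ℂ) (ρ + 2)).indicator h := ⟨_, rfl⟩
  have hgi : Integrable g (volume : Measure ℂ) := by
    rw [hg, integrable_indicator_iff measurableSet_closedBall]
    exact (locallyIntegrable_iff.1 hh) _ (isCompact_closedBall _ _)
  have h2 : ∀ w, h w * (∫ z, ψ (w + z) * η z) = g w * ∫ z, ψ (w + z) * η z := fun w => by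
    by_cases hmem : w ∈ Metric.closedBall (0 : ℂ) (ρ + 2)
    · rw [hg, Set.indicator_of_mem hmem]
    · have : ∀ z, ψ (w + z) * η z = 0 := fun z => by
        by_cases hz : 2 < ‖z‖
        · rw [hp.remainder_eq_zero z hz, mul_zero]
        · rw [hρ (w + z), zero_mul]
          rw [mem_closedBall_zero_iff] at hmem
          have := norm_sub_le (w + z) z
          rw [add_sub_cancel_right] at this
          linarith
      simp [this]
  have h3 : ∀ z, conv g η z * ψ z = conv h η z * ψ z := fun z => by
    by_cases hz : ρ < ‖z‖
    · rw [hρ z hz, mul_zero, mul_zero]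
    · congr 1
      rw [conv_apply, conv_apply]
      refine integral_congr_ae (ae_of_all _ fun t => ?_)
      dsimp only
      by_cases hmem : t ∈ Metric.closedBall (0 : ℂ) (ρ + 2)
      · rw [hg, Set.indicator_of_mem hmem]
      · rw [hp.remainder_eq_zero (z - t), mul_zero, mul_zero]
        rw [mem_closedBall_zero_iff] at hmem
        have := norm_sub_norm_le t z
        rw [norm_sub_rev] at this
        linarith
  have i3 : Integrable (fun w => h w * ∫ z, ψ (w + z) * η z) (volume : Measure ℂ) := by
    simp only [h2]
    exact integrable_mul_integral hgi hp.integrable_remainder hψ.continuous hM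
  have e1 : ∀ w, h w * (-ψ w - ∫ z, ψ (w + z) * η z) =
      -(h w * ψ w) - h w * ∫ z, ψ (w + z) * η z := fun w => by ring
  simp only [e1] at h1
  rw [integral_sub (f := fun w => -(h w * ψ w)) i1.neg i3, integral_neg] at h1
  simp only [h2] at h1
  rw [← integral_conv_mul hgi hp.integrable_remainder hψ.continuous hM] at h1
  simp only [h3] at h1
  linear_combination -h1

end IsParametrix

/-- Weyl's lemma for `∂̄`. -/
lemma exists_entire_of_hasWeakDbar_zero {h : ℂ → ℂ}
    (hh : LocallyIntegrable h (volume : Measure ℂ)) (hw : HasWeakDbar h 0) :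
    ∃ g : ℂ → ℂ, Differentiable ℂ g ∧ h =ᵐ[volume] g := by
  obtain ⟨k, η, hp⟩ := exists_parametrix
  have hηs := hp.hasCompactSupport_remainder
  have hη1 : ContDiff ℝ 1 η := by exact_mod_cast contDiff_infty.1 hp.contDiff_remainder 1
  have hcd : ContDiff ℝ 1 (conv h η) := hηs.contDiff_convolution_right (n := 1) _ hh hη1
  have hd0 : ∀ z, dbar (conv h η) z = 0 := fun z => by
    rw [dbar_conv hh hη1 hηs, conv_apply]
    -- `∂̄` falls on `η`, and up to sign the integral is `h` tested against `∂̄` of the test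
    -- function `t ↦ η (z - t)`.
    have h1 := hw (fun t => η (z - t)) (hp.contDiff_remainder.comp (contDiff_const.sub contDiff_id))
      (hasCompactSupport_of_eq_zero (r := ‖z‖ + 2) fun t ht => hp.remainder_eq_zero _ (by
        have := norm_sub_norm_le t z
        rw [norm_sub_rev] at this
        linarith))
    have h2 : ∀ t, dbar (fun t => η (z - t)) t = -dbar η (z - t) := fun t => by
      have h3 : HasFDerivAt (fun t => z - t) (-ContinuousLinearMap.id ℝ ℂ) t :=
        (hasFDerivAt_id t).const_sub z
      have h4 := ((hη1.differentiable one_ne_zero (z - t)).hasFDerivAt.comp t h3).fderiv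
      have h5 : fderiv ℝ (fun t => η (z - t)) t = _ := h4
      simp only [dbar, h5]
      simp
      ring
    simp only [h2, mul_neg, integral_neg, Pi.zero_apply, zero_mul, integral_zero, neg_zero,
      neg_eq_zero] at h1
    exact h1
  -- Formally `0 = ∂̄h * k = h * (δ₀ + η)`, so `h` must equal `-(h * η)`.
  refine ⟨fun z => -conv h η z, Differentiable.neg fun z => ?_, ?_⟩
  · rw [differentiableAt_complex_iff_differentiableAt_real]
    refine ⟨hcd.differentiable one_ne_zero z, ?_⟩
    have := hd0 z
    rw [dbar] at this
    have h3 : fderiv ℝ (conv h η) z 1 + Complex.I * fderiv ℝ (conv h η) z Complex.I = 0 := by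
      simpa using this
    rw [smul_eq_mul]
    linear_combination -Complex.I * h3 + fderiv ℝ (conv h η) z Complex.I * Complex.I_mul_I
  · refine ae_eq_of_integral_contDiff_smul_eq hh hcd.continuous.neg.locallyIntegrable
      fun g hg hgs => ?_
    have := hp.integral_eq_of_hasWeakDbar_zero hh hw (ψ := fun z => (g z : ℂ))
      (Complex.ofRealCLM.contDiff.comp hg) (hgs.comp_left (g := fun x : ℝ => (x : ℂ)) rfl)
    simp only [Complex.real_smul, mul_comm (Complex.ofReal _), neg_mul, integral_neg]
    exact this

lemma hasWeakDbar_zero_of_entire {g : ℂ → ℂ} (hg : Differentiable ℂ g) : HasWeakDbar g 0 := by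
  intro ψ hψ hc
  have hψ1 : ContDiff ℝ 1 ψ := by exact_mod_cast contDiff_infty.1 hψ 1
  have hg1 : ContDiff ℝ 1 g := (hg.contDiff (n := 1)).restrict_scalars ℝ
  have h := integral_dbar_eq_zero (hg1.mul hψ1) hc.mul_left
  have h2 : ∀ z, dbar (fun w => g w * ψ w) z = g z * dbar ψ z := fun z => by
    rw [dbar_mul (hg1.differentiable one_ne_zero z) (hψ1.differentiable one_ne_zero z),
      dbar_eq_zero_of_differentiableAt (hg z), zero_mul, zero_add]
  have h3 : ∫ z, dbar (fun w => g w * ψ w) z = 0 := h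
  simp only [h2] at h3
  simp [h3]

/-! ### Compactness of localized convolution operators -/

section HilbertSchmidt

variable {X H : Type*} [MeasurableSpace X] [NormedAddCommGroup H] [NormedSpace ℂ H]

/-- The operator `f ↦ (x ↦ G x f)` defined by a square integrable family `G` of functionals. -/
def familyOp (μ : Measure X) : Lp (H →L[ℂ] ℂ) 2 μ →L[ℂ] H →L[ℂ] Lp ℂ 2 μ :=
  (ContinuousLinearMap.compLpL₂ 2 μ (ContinuousLinearMap.apply ℂ ℂ (E := H))).flip

lemma coe_familyOp {μ : Measure X} (G : Lp (H →L[ℂ] ℂ) 2 μ) (f : H) :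
    familyOp μ G f =ᵐ[μ] fun x => G x f :=
  ContinuousLinearMap.coeFn_compLp _ _

/-- A family `c · 1_s` gives an operator factoring through `ℂ`, hence of rank at most one. Sums of
these are dense in `L²`, the operator depends continuously on `G`, and compact operators are closed
in norm. -/
lemma isCompactOperator_familyOp {μ : Measure X} (G : Lp (H →L[ℂ] ℂ) 2 μ) :
    IsCompactOperator (familyOp μ G) := by
  refine Lp.induction ENNReal.ofNat_ne_top
    (motive := fun G : Lp (H →L[ℂ] ℂ) 2 μ => IsCompactOperator (familyOp μ G)) ?_ ?_ ?_ G
  · intro c s hs hμs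
    obtain ⟨v, hv⟩ : ∃ v : Lp ℂ 2 μ, v = indicatorConstLp 2 hs hμs.ne 1 := ⟨_, rfl⟩
    have h : (familyOp μ (Lp.simpleFunc.indicatorConst 2 hs hμs.ne c) : H → Lp ℂ 2 μ) =
        (ContinuousLinearMap.toSpanSingleton ℂ v) ∘ c := by
      ext1 f
      refine Lp.ext ((coe_familyOp _ f).trans ?_)
      rw [Lp.simpleFunc.coe_indicatorConst, Function.comp_apply,
        ContinuousLinearMap.toSpanSingleton_apply, hv]
      filter_upwards [Lp.coeFn_smul (c f) (indicatorConstLp 2 hs hμs.ne (1 : ℂ)),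
        indicatorConstLp_coeFn (p := 2) (hs := hs) (hμs := hμs.ne) (c := c),
        indicatorConstLp_coeFn (p := 2) (hs := hs) (hμs := hμs.ne) (c := (1 : ℂ))] with x h1 h2 h3
      rw [h1, h2, Pi.smul_apply, h3]
      by_cases hx : x ∈ s <;> simp [hx]
    have hc : IsCompactOperator (ContinuousLinearMap.toSpanSingleton ℂ v ∘ (id : ℂ → ℂ)) :=
      isCompactOperator_id.clm_comp (ContinuousLinearMap.toSpanSingleton ℂ v)
    rw [h]
    exact hc.comp_clm c
  · intro f g hf hg _ h1 h2
    rw [map_add]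
    exact h1.add h2
  · exact isClosed_setOfPred_isCompactOperator.preimage (familyOp μ).continuous

end HilbertSchmidt

/-- Young's inequality for the convolution of an `L²` function with an `L¹` function. -/
lemma eLpNorm_conv_le {g k : ℂ → ℂ} (hg : AEStronglyMeasurable g (volume : Measure ℂ))
    (hk : AEStronglyMeasurable k (volume : Measure ℂ)) :
    eLpNorm (conv g k) 2 volume ≤ eLpNorm k 1 volume * eLpNorm g 2 volume := by
  have hgm := hg.enorm
  have hkm := hk.enorm
  have hkz : ∀ z : ℂ, AEMeasurable (fun t => ‖k (z - t)‖ₑ) (volume : Measure ℂ) := fun z =>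
    hkm.comp_quasiMeasurePreserving
      (Measure.measurePreserving_sub_left (volume : Measure ℂ) z).quasiMeasurePreserving
  have hpt : ∀ z, ‖conv g k z‖ₑ ^ 2 ≤
      (∫⁻ t, ‖k t‖ₑ) * ∫⁻ t, ‖g t‖ₑ ^ 2 * ‖k (z - t)‖ₑ := by
    intro z
    have h1 : ‖conv g k z‖ₑ ≤ ∫⁻ t, ‖g t‖ₑ * ‖k (z - t)‖ₑ := by
      refine (enorm_integral_le_lintegral_enorm _).trans_eq ?_
      refine lintegral_congr fun t => ?_
      simp [enorm_mul]
    have hsq : ∀ x : ℝ≥0∞, (x ^ (1 / 2 : ℝ)) ^ (2 : ℝ) = x := fun x => by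
      rw [← ENNReal.rpow_mul]; norm_num
    have hsq' : ∀ x : ℝ≥0∞, x ^ (1 / 2 : ℝ) * x ^ (1 / 2 : ℝ) = x := fun x => by
      rw [← sq, ← ENNReal.rpow_natCast]; exact_mod_cast hsq x
    -- Cauchy–Schwarz after writing `|g| |k| = |k|^{1/2} · (|g| |k|^{1/2})`; Tonelli then integrates
    -- the second factor.
    have h2 := ENNReal.lintegral_mul_le_Lp_mul_Lq (volume : Measure ℂ) Real.HolderConjugate.two_two
      (f := fun t => ‖k (z - t)‖ₑ ^ (1 / 2 : ℝ)) (g := fun t => ‖g t‖ₑ * ‖k (z - t)‖ₑ ^ (1 / 2 : ℝ))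
      ((hkz z).pow_const _) (hgm.mul ((hkz z).pow_const _))
    have h3 : ∀ t, ((fun t => ‖k (z - t)‖ₑ ^ (1 / 2 : ℝ)) *
        fun t => ‖g t‖ₑ * ‖k (z - t)‖ₑ ^ (1 / 2 : ℝ)) t = ‖g t‖ₑ * ‖k (z - t)‖ₑ := fun t => by
      rw [Pi.mul_apply, mul_left_comm, hsq']
    simp only [h3, hsq, ENNReal.mul_rpow_of_nonneg _ _ (zero_le_two : (0 : ℝ) ≤ 2)] at h2
    calc ‖conv g k z‖ₑ ^ 2 ≤ _ := pow_le_pow_left₀ zero_le (h1.trans h2) 2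
      _ = (∫⁻ t, ‖k (z - t)‖ₑ) * ∫⁻ t, ‖g t‖ₑ ^ (2 : ℝ) * ‖k (z - t)‖ₑ := by
          rw [mul_pow, ← ENNReal.rpow_natCast, ← ENNReal.rpow_natCast]
          push_cast
          rw [hsq, hsq]
      _ = _ := by
          rw [lintegral_sub_left_eq_self (fun t => ‖k t‖ₑ) z]
          simp only [ENNReal.rpow_two]
  have hmain : ∫⁻ z, ‖conv g k z‖ₑ ^ 2 ≤ (∫⁻ t, ‖k t‖ₑ) ^ 2 * ∫⁻ t, ‖g t‖ₑ ^ 2 := by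
    have hprod : AEMeasurable (fun p : ℂ × ℂ => ‖g p.2‖ₑ ^ 2 * ‖k (p.1 - p.2)‖ₑ)
        ((volume : Measure ℂ).prod volume) := by
      refine AEMeasurable.mul ((hgm.comp_quasiMeasurePreserving
        Measure.quasiMeasurePreserving_snd).pow_const 2) ?_
      exact hkm.comp_quasiMeasurePreserving
        (quasiMeasurePreserving_sub_of_right_invariant (volume : Measure ℂ) volume)
    calc _ ≤ ∫⁻ z, (∫⁻ t, ‖k t‖ₑ) * ∫⁻ t, ‖g t‖ₑ ^ 2 * ‖k (z - t)‖ₑ := lintegral_mono hpt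
      _ = (∫⁻ t, ‖k t‖ₑ) * ∫⁻ z, ∫⁻ t, ‖g t‖ₑ ^ 2 * ‖k (z - t)‖ₑ :=
          lintegral_const_mul'' _ hprod.lintegral_prod_right'
      _ = (∫⁻ t, ‖k t‖ₑ) * ∫⁻ t, ∫⁻ z, ‖g t‖ₑ ^ 2 * ‖k (z - t)‖ₑ := by
          rw [lintegral_lintegral_swap hprod]
      _ = (∫⁻ t, ‖k t‖ₑ) * ∫⁻ t, ‖g t‖ₑ ^ 2 * ∫⁻ z, ‖k z‖ₑ := by
          congr 1
          refine lintegral_congr fun t => ?_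
          have hkt : AEMeasurable (fun z => ‖k (z - t)‖ₑ) (volume : Measure ℂ) :=
            hkm.comp_quasiMeasurePreserving
              (measurePreserving_sub_right (volume : Measure ℂ) t).quasiMeasurePreserving
          rw [lintegral_const_mul'' _ hkt,
            lintegral_sub_right_eq_self (fun z => ‖k z‖ₑ) t]
      _ = _ := by
          rw [lintegral_mul_const'' _ (hgm.pow_const 2)]
          ring
  have hL2 : ∀ f : ℂ → ℂ, eLpNorm f 2 volume ^ 2 = ∫⁻ z, ‖f z‖ₑ ^ 2 := fun f => by
    rw [eLpNorm_eq_lintegral_rpow_enorm_toReal two_ne_zero (by simp), ← ENNReal.rpow_natCast,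
      ← ENNReal.rpow_mul]
    simp
  rw [← ENNReal.pow_le_pow_left_iff two_ne_zero, mul_pow, hL2, hL2, eLpNorm_one_eq_lintegral_enorm]
  exact hmain

/-! ### Truncated convolution operators on `L²_φ`. -/

section TruncatedConvolution

variable {φ : ℂ → ℝ}

/-- Convolution with `k`, cut off to the disc of radius `r` before and to the disc of radius `R`
after. -/
def truncConv (r R : ℝ) (k f : ℂ → ℂ) : ℂ → ℂ :=
  (Metric.closedBall (0 : ℂ) R).indicator (conv ((Metric.closedBall (0 : ℂ) r).indicator f) k)

lemma integrable_indicator_coe (hφ : Continuous φ) (r : ℝ) (f : L2w φ) :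
    Integrable ((Metric.closedBall (0 : ℂ) r).indicator f) (volume : Measure ℂ) := by
  rw [integrable_indicator_iff measurableSet_closedBall]
  exact (locallyIntegrable_iff.1 (locallyIntegrable_coe hφ f)) _ (isCompact_closedBall _ _)

/-- Young's inequality between two comparisons of measures, one on each disc. `A` does not depend on
`k`, so approximating the kernel in `L¹` approximates the operator in norm. -/
lemma exists_eLpNorm_truncConv_le (hφ : Continuous φ) (r R : ℝ) :
    ∃ A : ℝ≥0, ∀ (k : ℂ → ℂ), Integrable k (volume : Measure ℂ) → ∀ f : L2w φ,
      AEStronglyMeasurable (truncConv r R k f) (weightedMeasure φ) ∧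
      eLpNorm (truncConv r R k f) 2 (weightedMeasure φ) ≤
        A * eLpNorm k 1 volume * eLpNorm f 2 (weightedMeasure φ) := by
  obtain ⟨c, hc⟩ := exists_restrict_le_smul_weightedMeasure hφ (isCompact_closedBall (0 : ℂ) r)
  obtain ⟨c', hc'⟩ := exists_weightedMeasure_restrict_le_smul hφ (isCompact_closedBall (0 : ℂ) R)
  refine ⟨c' ^ (2⁻¹ : ℝ) * c ^ (2⁻¹ : ℝ), fun k hk f => ?_⟩
  have hg := integrable_indicator_coe hφ r f
  have hm : AEStronglyMeasurable (conv ((Metric.closedBall (0 : ℂ) r).indicator f) k)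
      (volume : Measure ℂ) := (hg.integrable_convolution _ hk).aestronglyMeasurable
  refine ⟨(hm.mono_ac weightedMeasure_absolutelyContinuous).indicator measurableSet_closedBall, ?_⟩
  have h1 : eLpNorm (truncConv r R k f) 2 (weightedMeasure φ) ≤
      (c' : ℝ≥0∞) ^ (2⁻¹ : ℝ) *
        eLpNorm (conv ((Metric.closedBall (0 : ℂ) r).indicator f) k) 2 volume := by
    rw [truncConv, eLpNorm_indicator_eq_eLpNorm_restrict measurableSet_closedBall]
    refine (eLpNorm_le_of_measure_le_smul (c := c') (by simpa using hc')).trans_eq ?_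
    simp
  have h2 := eLpNorm_conv_le hg.aestronglyMeasurable hk.aestronglyMeasurable
  have h3 : eLpNorm ((Metric.closedBall (0 : ℂ) r).indicator f) 2 (volume : Measure ℂ) ≤
      (c : ℝ≥0∞) ^ (2⁻¹ : ℝ) * eLpNorm f 2 (weightedMeasure φ) := by
    rw [eLpNorm_indicator_eq_eLpNorm_restrict measurableSet_closedBall]
    refine (eLpNorm_le_of_measure_le_smul (c := c) (by simpa using hc)).trans_eq ?_
    simp
  calc _ ≤ _ := h1
    _ ≤ (c' : ℝ≥0∞) ^ (2⁻¹ : ℝ) * (eLpNorm k 1 volume *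
        ((c : ℝ≥0∞) ^ (2⁻¹ : ℝ) * eLpNorm f 2 (weightedMeasure φ))) := by
        gcongr
        exact h2.trans (by gcongr)
    _ = _ := by
        rw [ENNReal.coe_mul, ENNReal.coe_rpow_of_nonneg _ (by norm_num),
          ENNReal.coe_rpow_of_nonneg _ (by norm_num)]
        ring

lemma conv_congr_left {g g' k : ℂ → ℂ} (h : g =ᵐ[volume] g') : conv g k = conv g' k := by
  ext z
  rw [conv_apply, conv_apply]
  refine integral_congr_ae ?_
  filter_upwards [h] with t ht
  rw [ht]

/-- `T` is the operator `f ↦ truncConv r R k f` on `L²_φ`. -/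
def IsTruncConv (r R : ℝ) (k : ℂ → ℂ) (T : L2w φ →L[ℂ] L2w φ) : Prop :=
  ∀ f : L2w φ, T f =ᵐ[volume] truncConv r R k f

/-- Truncated convolution operators exist, with norm controlled by the `L¹` norm of the kernel. -/
lemma exists_isTruncConv (hφ : Continuous φ) (r R : ℝ) :
    ∃ A : ℝ, 0 ≤ A ∧ ∀ k : ℂ → ℂ, Integrable k (volume : Measure ℂ) →
      ∃ T : L2w φ →L[ℂ] L2w φ, IsTruncConv r R k T ∧ ‖T‖ ≤ A * ∫ z, ‖k z‖ := by
  obtain ⟨A, hA⟩ := exists_eLpNorm_truncConv_le hφ r R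
  refine ⟨A, A.2, fun k hk => ?_⟩
  have hk1 : eLpNorm k 1 volume = ENNReal.ofReal (∫ z, ‖k z‖) := by
    rw [eLpNorm_one_eq_lintegral_enorm, ofReal_integral_norm_eq_lintegral_enorm hk]
  have hmem : ∀ f : L2w φ, MemLp (truncConv r R k f) 2 (weightedMeasure φ) := fun f =>
    ⟨(hA k hk f).1, (hA k hk f).2.trans_lt (by
      rw [hk1]
      exact ENNReal.mul_lt_top (ENNReal.mul_lt_top ENNReal.coe_lt_top ENNReal.ofReal_lt_top)
        (Lp.memLp f).2)⟩
  have hae := ae_weightedMeasure hφ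
  have hadd : ∀ f g : L2w φ, truncConv r R k (f + g : L2w φ) =ᵐ[weightedMeasure φ]
      truncConv r R k f + truncConv r R k g := by
    intro f g
    rw [hae]
    have h1 : ((f + g : L2w φ) : ℂ → ℂ) =ᵐ[volume] f + g := by
      rw [← hae]; exact Lp.coeFn_add f g
    have h2 : (Metric.closedBall (0 : ℂ) r).indicator ((f + g : L2w φ) : ℂ → ℂ) =ᵐ[volume]
        (Metric.closedBall (0 : ℂ) r).indicator f + (Metric.closedBall (0 : ℂ) r).indicator g := by
      filter_upwards [h1] with x hx
      by_cases hxr : x ∈ Metric.closedBall (0 : ℂ) r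
      · simp only [Pi.add_apply, Set.indicator_of_mem hxr, hx]
      · simp only [Pi.add_apply, Set.indicator_of_notMem hxr, add_zero]
    simp only [truncConv, conv_congr_left h2]
    filter_upwards [(integrable_indicator_coe hφ r f).ae_convolution_exists
      (ContinuousLinearMap.mul ℝ ℂ) hk, (integrable_indicator_coe hφ r g).ae_convolution_exists
      (ContinuousLinearMap.mul ℝ ℂ) hk] with z hf hg
    have h3 := hf.add_distrib hg
    by_cases hz : z ∈ Metric.closedBall (0 : ℂ) R
    · simp only [Pi.add_apply, Set.indicator_of_mem hz]
      exact h3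
    · simp only [Pi.add_apply, Set.indicator_of_notMem hz, add_zero]
  have hsmul : ∀ (c : ℂ) (f : L2w φ), truncConv r R k (c • f : L2w φ) =ᵐ[weightedMeasure φ]
      c • truncConv r R k f := by
    intro c f
    rw [hae]
    have h1 : ((c • f : L2w φ) : ℂ → ℂ) =ᵐ[volume] c • f := by
      rw [← hae]; exact Lp.coeFn_smul c f
    have h2 : (Metric.closedBall (0 : ℂ) r).indicator ((c • f : L2w φ) : ℂ → ℂ) =ᵐ[volume]
        c • (Metric.closedBall (0 : ℂ) r).indicator f := by
      filter_upwards [h1] with x hx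
      by_cases hxr : x ∈ Metric.closedBall (0 : ℂ) r
      · simp only [Pi.smul_apply, Set.indicator_of_mem hxr, hx]
      · simp only [Pi.smul_apply, Set.indicator_of_notMem hxr, smul_zero]
    simp only [truncConv, conv_congr_left h2]
    refine ae_of_all _ fun z => ?_
    by_cases hz : z ∈ Metric.closedBall (0 : ℂ) R
    · simp only [Pi.smul_apply, Set.indicator_of_mem hz, conv_apply, smul_eq_mul, mul_assoc]
      rw [integral_const_mul]
    · simp only [Pi.smul_apply, Set.indicator_of_notMem hz, smul_zero]
  let T0 : L2w φ →ₗ[ℂ] L2w φ :=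
    { toFun := fun f => (hmem f).toLp
      map_add' := fun f g => by
        rw [← MemLp.toLp_add]
        exact MemLp.toLp_congr _ _ (hadd f g)
      map_smul' := fun c f => by
        rw [RingHom.id_apply, ← MemLp.toLp_const_smul]
        exact MemLp.toLp_congr _ _ (hsmul c f) }
  have hk0 : 0 ≤ ∫ z, ‖k z‖ := integral_nonneg fun z => norm_nonneg _
  have hb : ∀ f, ‖T0 f‖ ≤ (A * ∫ z, ‖k z‖) * ‖f‖ := fun f => by
    change ‖(hmem f).toLp‖ ≤ _
    rw [Lp.norm_toLp]
    refine ENNReal.toReal_le_of_le_ofReal (by positivity) ?_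
    refine (hA k hk f).2.trans_eq ?_
    rw [hk1, ENNReal.ofReal_mul (by positivity), ENNReal.ofReal_mul A.coe_nonneg, ENNReal.ofReal_coe_nnreal,
      Lp.norm_def, ENNReal.ofReal_toReal (Lp.memLp f).2.ne]
  refine ⟨T0.mkContinuous _ hb, fun f => ?_, LinearMap.mkContinuous_norm_le _ (by positivity) _⟩
  rw [← hae]
  exact (hmem f).coeFn_toLp

lemma IsTruncConv.ext (hφ : Continuous φ) {r R : ℝ} {k : ℂ → ℂ} {T T' : L2w φ →L[ℂ] L2w φ}
    (h : IsTruncConv r R k T) (h' : IsTruncConv r R k T') : T = T' := by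
  ext1 f
  refine Lp.ext ?_
  rw [ae_weightedMeasure hφ]
  exact (h f).trans (h' f).symm

lemma IsTruncConv.sub (hφ : Continuous φ) {r R : ℝ} {k k' : ℂ → ℂ} {T T' : L2w φ →L[ℂ] L2w φ}
    (hk : Integrable k (volume : Measure ℂ)) (hk' : Integrable k' (volume : Measure ℂ))
    (h : IsTruncConv r R k T) (h' : IsTruncConv r R k' T') :
    IsTruncConv r R (fun z => k z - k' z) (T - T') := by
  intro f
  have h0 : ((T - T') f : ℂ → ℂ) =ᵐ[volume] T f - T' f := by
    rw [← ae_weightedMeasure hφ]; exact Lp.coeFn_sub (T f) (T' f)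
  filter_upwards [h0, h f, h' f, (integrable_indicator_coe hφ r f).ae_convolution_exists
      (ContinuousLinearMap.mul ℝ ℂ) hk, (integrable_indicator_coe hφ r f).ae_convolution_exists
      (ContinuousLinearMap.mul ℝ ℂ) hk'] with z h1 h2 h3 i1 i2
  rw [h1, Pi.sub_apply, h2, h3]
  simp only [truncConv]
  by_cases hz : z ∈ Metric.closedBall (0 : ℂ) R
  · simp only [Set.indicator_of_mem hz, conv_apply, mul_sub]
    exact (integral_sub i1 i2).symm
  · simp only [Set.indicator_of_notMem hz, sub_zero]

/-- `A²` is the integral of `e^{2φ}` over the disc. The bound converts uniform continuity of a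
kernel into continuity of its translates in `L²_φ`. -/
lemma exists_norm_indicatorL_expEmbed_le (hφ : Continuous φ) (r : ℝ) :
    ∃ A : ℝ, 0 ≤ A ∧ ∀ (g : CcSubmodule) (s : ℝ), 0 ≤ s → (∀ z, ‖g.1 z‖ ≤ s) →
      ‖indicatorL (weightedMeasure φ) (measurableSet_closedBall (x := (0 : ℂ)) (ε := r))
        (expEmbed hφ g)‖ ≤ A * s := by
  have hi : Integrable ((Metric.closedBall (0 : ℂ) r).indicator fun z => Real.exp (2 * φ z))
      (volume : Measure ℂ) := by
    rw [integrable_indicator_iff measurableSet_closedBall]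
    exact (by fun_prop : Continuous fun z => Real.exp (2 * φ z)).continuousOn.integrableOn_compact
      (isCompact_closedBall _ _)
  refine ⟨√(∫ z, (Metric.closedBall (0 : ℂ) r).indicator (fun z => Real.exp (2 * φ z)) z),
    Real.sqrt_nonneg _, fun g s hs hg => ?_⟩
  have hI : 0 ≤ ∫ z, (Metric.closedBall (0 : ℂ) r).indicator (fun z => Real.exp (2 * φ z)) z :=
    integral_nonneg fun z => Set.indicator_nonneg (fun _ _ => Real.exp_nonneg _) _
  refine le_of_sq_le_sq ?_ (by positivity)
  rw [mul_pow, Real.sq_sqrt hI, norm_sq_L2w hφ, ← integral_mul_const]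
  refine integral_mono_of_nonneg (ae_of_all _ fun z => by positivity) (hi.mul_const _) ?_
  have h4 := coe_indicatorL (μ := weightedMeasure φ)
    (measurableSet_closedBall (x := (0 : ℂ)) (ε := r)) (expEmbed hφ g)
  rw [ae_weightedMeasure hφ] at h4
  filter_upwards [h4, coe_expEmbed hφ g] with z hz hz'
  rw [hz]
  by_cases h : z ∈ Metric.closedBall (0 : ℂ) r
  · rw [Set.indicator_of_mem h, Set.indicator_of_mem h, hz', norm_mul, mul_pow, Complex.norm_real,
      Real.norm_of_nonneg (Real.exp_nonneg _)]
    have : Real.exp (-2 * φ z) * Real.exp (2 * φ z) = 1 := by rw [← Real.exp_add]; simp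
    calc _ = Real.exp (2 * φ z) * ‖g.1 z‖ ^ 2 := by
          linear_combination (Real.exp (2 * φ z) * ‖g.1 z‖ ^ 2) * this
      _ ≤ _ := by gcongr; exact hg z
  · simp [Set.indicator_of_notMem h]

lemma memLp_indicator_of_continuous (hφ : Continuous φ) (R : ℝ) {E : Type*}
    [NormedAddCommGroup E] {Λ : ℂ → E} (hΛ : Continuous Λ) :
    MemLp ((Metric.closedBall (0 : ℂ) R).indicator Λ) 2 (weightedMeasure φ) := by
  obtain ⟨c, hcle⟩ := exists_weightedMeasure_restrict_le_smul hφ (isCompact_closedBall (0 : ℂ) R)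
  rw [memLp_indicator_iff_restrict measurableSet_closedBall]
  have h1 : MemLp Λ 2 ((volume : Measure ℂ).restrict (Metric.closedBall (0 : ℂ) R)) := by
    obtain ⟨D, hD⟩ := (isCompact_closedBall (0 : ℂ) R).exists_bound_of_continuousOn
      hΛ.continuousOn
    have : IsFiniteMeasure ((volume : Measure ℂ).restrict (Metric.closedBall (0 : ℂ) R)) :=
      ⟨by simpa using (isCompact_closedBall (0 : ℂ) R).measure_lt_top (μ := volume)⟩
    exact MemLp.of_bound hΛ.aestronglyMeasurable D
      ((ae_restrict_iff' measurableSet_closedBall).2 (ae_of_all _ hD))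
  refine h1.of_measure_le_smul (c := c) (by simp) ?_
  have h2 := Measure.restrict_mono_measure hcle (Metric.closedBall (0 : ℂ) R)
  rw [Measure.restrict_restrict measurableSet_closedBall, Set.inter_self,
    Measure.restrict_smul] at h2
  simpa using h2

/-- Truncated convolution with a continuous compactly supported kernel is Hilbert–Schmidt. -/
lemma IsTruncConv.isCompactOperator_of_continuous (hφ : Continuous φ) {r R : ℝ} {k : ℂ → ℂ}
    {T : L2w φ →L[ℂ] L2w φ} (h : IsTruncConv r R k T) (hk : Continuous k)
    (hc : HasCompactSupport k) : IsCompactOperator T := by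
  obtain ⟨A, hA0, hA⟩ := exists_norm_indicatorL_expEmbed_le hφ r
  obtain ⟨M, hM⟩ : ∃ M, M = indicatorL (weightedMeasure φ)
    (measurableSet_closedBall (x := (0 : ℂ)) (ε := r)) := ⟨_, rfl⟩
  rw [← hM] at hA
  -- After multiplication by `e^{2φ}` and cut-off, `g z` is the Riesz vector of the functional
  -- sending `f` to the value at `z` of the truncated convolution.
  let g : ℂ → CcSubmodule := fun z => ⟨fun t => conj (k (z - t)),
    Complex.continuous_conj.comp (hk.comp (continuous_const.sub continuous_id)),
    hasCompactSupport_conj (hc.comp_homeomorph (Homeomorph.subLeft z))⟩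
  have hcont : Continuous fun z => M (expEmbed hφ (g z)) := by
    rw [Metric.continuous_iff]
    intro z ε hε
    -- `A + 1` rather than `A`, since `A` may vanish.
    obtain ⟨δ, hδ, hδ'⟩ := Metric.uniformContinuous_iff.1 (hc.uniformContinuous_of_continuous hk)
      (ε / (A + 1)) (by positivity)
    refine ⟨δ, hδ, fun w hw => ?_⟩
    rw [dist_eq_norm, ← map_sub, ← map_sub]
    refine (hA (g w - g z) (ε / (A + 1)) (by positivity) fun t => ?_).trans_lt ?_
    · have := hδ' (a := w - t) (b := z - t) (by simpa using hw)
      rw [dist_eq_norm] at this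
      change ‖conj (k (w - t)) - conj (k (z - t))‖ ≤ _
      rw [← map_sub, RCLike.norm_conj]
      exact this.le
    · rw [mul_div_assoc', div_lt_iff₀ (by positivity)]
      nlinarith
  have hΛ : Continuous fun z => innerSL ℂ (M (expEmbed hφ (g z))) :=
    (innerSL ℂ).continuous.comp hcont
  have happ : ∀ z (f : L2w φ), innerSL ℂ (M (expEmbed hφ (g z))) f =
      conv ((Metric.closedBall (0 : ℂ) r).indicator f) k z := fun z f => by
    have h1 : M f =ᵐ[volume] (Metric.closedBall (0 : ℂ) r).indicator f := by
      rw [← ae_weightedMeasure hφ, hM]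
      exact coe_indicatorL _ _
    rw [innerSL_apply_apply, hM, inner_indicatorL, ← inner_conj_symm, ← inner_indicatorL, ← hM,
      inner_expEmbed, ← integral_conj, conv_apply]
    refine integral_congr_ae ?_
    filter_upwards [h1] with t ht
    simp [g, ht]
  have hmem : MemLp ((Metric.closedBall (0 : ℂ) R).indicator
      fun z => innerSL ℂ (M (expEmbed hφ (g z)))) 2 (weightedMeasure φ) :=
    memLp_indicator_of_continuous hφ R hΛ
  have hT : (T : L2w φ → L2w φ) = familyOp (weightedMeasure φ) hmem.toLp := by
    ext1 f
    refine Lp.ext ?_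
    have h1 := coe_familyOp hmem.toLp f
    have h2 := hmem.coeFn_toLp
    have h3 := h f
    rw [← ae_weightedMeasure hφ] at h3
    filter_upwards [h1, h2, h3] with z e1 e2 e3
    rw [e1, e2, e3, truncConv]
    by_cases hz : z ∈ Metric.closedBall (0 : ℂ) R
    · rw [Set.indicator_of_mem hz, Set.indicator_of_mem hz, happ]
    · rw [Set.indicator_of_notMem hz, Set.indicator_of_notMem hz]
      rfl
  rw [hT]
  exact isCompactOperator_familyOp _

/-- Truncated convolution with an integrable kernel is compact. -/
lemma IsTruncConv.isCompactOperator (hφ : Continuous φ) {r R : ℝ} {k : ℂ → ℂ}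
    {T : L2w φ →L[ℂ] L2w φ} (h : IsTruncConv r R k T) (hk : Integrable k (volume : Measure ℂ)) :
    IsCompactOperator T := by
  obtain ⟨A, hA0, hA⟩ := exists_isTruncConv hφ r R
  have hmem : T ∈ closure {T : L2w φ →L[ℂ] L2w φ | IsCompactOperator T} := by
    rw [Metric.mem_closure_iff]
    intro ε hε
    -- Density of `C_c` in `L¹`: the operators of `k` and `k'` differ in norm by at most `A` times
    -- the `L¹` distance.
    obtain ⟨k', hc', hle, hcont', hk'⟩ := hk.exists_hasCompactSupport_integral_sub_le
      (ε := ε / (A + 1)) (by positivity)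
    obtain ⟨T', hT', -⟩ := hA k' hk'
    obtain ⟨T'', hT'', hn⟩ := hA (fun z => k z - k' z) (hk.sub hk')
    refine ⟨T', hT'.isCompactOperator_of_continuous hφ hcont' hc', ?_⟩
    rw [dist_eq_norm, (h.sub hφ hk hk' hT').ext hφ hT'']
    calc ‖T''‖ ≤ A * (ε / (A + 1)) := hn.trans (by gcongr)
      _ < ε := by
        rw [mul_div_assoc', div_lt_iff₀ (by positivity)]
        nlinarith
  rwa [isClosed_setOfPred_isCompactOperator.closure_eq] at hmem

end TruncatedConvolution

/-! ### The canonical solution operator -/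

/-- `S (M f + T' f)` lies in `Kᗮᗮ` and differs from `T f` by an element of `Kᗮ`, so it is the
projection of `T f`. Solving for `S ∘ M` leaves only compact terms. `K` need not be closed, whence
`Kᗮᗮ`. -/
lemma isCompactOperator_comp_of_sub_mem {H : Type*} [NormedAddCommGroup H]
    [InnerProductSpace ℂ H] [CompleteSpace H] {K : Submodule ℂ H} {S M T T' : H →L[ℂ] H}
    (hS : ∀ f, S f ∈ Kᗮᗮ) (hM : ∀ f, T f - S (M f + T' f) ∈ Kᗮ)
    (hT : IsCompactOperator T) (hT' : IsCompactOperator T') : IsCompactOperator (S ∘L M) := by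
  have heq : S ∘L M = Kᗮᗮ.starProjection ∘L T - S ∘L T' := by
    ext1 f
    have h : Kᗮᗮ.starProjection (T f) = S (M f + T' f) :=
      Submodule.eq_starProjection_of_mem_of_inner_eq_zero (hS _) fun w hw =>
        Submodule.inner_right_of_mem_orthogonal (hM f) hw
    rw [map_add] at h
    rw [sub_apply, ContinuousLinearMap.comp_apply, ContinuousLinearMap.comp_apply,
      ContinuousLinearMap.comp_apply, h, add_sub_cancel_right]
  rw [heq]
  exact (hT.clm_comp (Kᗮᗮ.starProjection)).sub (hT'.clm_comp S)

section Canonical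

variable {φ : ℂ → ℝ}

lemma HasWeakDbar.congr {u u' f f' : ℂ → ℂ} (h : HasWeakDbar u f) (hu : u =ᵐ[volume] u')
    (hf : f =ᵐ[volume] f') : HasWeakDbar u' f' := by
  intro ψ hψ hc
  have h1 : ∫ z, u' z * dbar ψ z = ∫ z, u z * dbar ψ z :=
    integral_congr_ae (by filter_upwards [hu] with z hz; rw [hz])
  have h2 : ∫ z, f' z * ψ z = ∫ z, f z * ψ z :=
    integral_congr_ae (by filter_upwards [hf] with z hz; rw [hz])
  rw [h1, h2]
  exact h ψ hψ hc

lemma mem_orthogonal_rangeDel_iff (hφ : Continuous φ) {u : L2w φ} :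
    u ∈ (rangeDel hφ)ᗮ ↔ HasWeakDbar u 0 := by
  have h0 : ((0 : L2w φ) : ℂ → ℂ) =ᵐ[volume] 0 := by
    rw [← ae_weightedMeasure hφ]; exact Lp.coeFn_zero _ _ _
  have h1 : HasWeakDbar u 0 ↔ HasWeakDbar u (0 : L2w φ) :=
    ⟨fun h => h.congr .rfl h0.symm, fun h => h.congr .rfl h0⟩
  rw [h1, hasWeakDbar_iff hφ, Submodule.mem_orthogonal']
  simp only [inner_zero_left, neg_zero]
  exact ⟨fun h α => h _ ⟨α, rfl⟩, fun h => by rintro _ ⟨α, rfl⟩; exact h α⟩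

/-- The entire functions in `L²_φ` are exactly the orthogonal complement of the range of the
formal adjoint of `∂̄`. -/
lemma A2w_eq_orthogonal_rangeDel (hφ : Continuous φ) : A2w φ = (rangeDel hφ)ᗮ := by
  ext u
  rw [mem_orthogonal_rangeDel_iff]
  constructor
  · rintro ⟨g, hg, hug⟩
    rw [ae_weightedMeasure hφ] at hug
    exact (hasWeakDbar_zero_of_entire hg).congr hug.symm .rfl
  · intro h
    obtain ⟨g, hg, hug⟩ := exists_entire_of_hasWeakDbar_zero (locallyIntegrable_coe hφ u) h
    refine ⟨g, hg, ?_⟩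
    rwa [ae_weightedMeasure hφ]

lemma sub_mem_orthogonal_rangeDel (hφ : Continuous φ) {u u' f : L2w φ} (h : HasWeakDbar u f)
    (h' : HasWeakDbar u' f) : u - u' ∈ (rangeDel hφ)ᗮ := by
  rw [hasWeakDbar_iff hφ] at h h'
  rw [Submodule.mem_orthogonal']
  rintro _ ⟨α, rfl⟩
  rw [LinearMap.comp_apply, inner_sub_left, h, h', sub_self]

/-- The parametrix turns local data into local solutions with a smooth local error. -/
lemma hasWeakDbar_truncConv (hφ : Continuous φ) {k η : ℂ → ℂ} (hp : IsParametrix k η) {r : ℝ}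
    {T T' : L2w φ →L[ℂ] L2w φ} (hT : IsTruncConv r (r + 2) k T)
    (hT' : IsTruncConv r (r + 2) η T') (f : L2w φ) :
    HasWeakDbar (T f) (indicatorL (weightedMeasure φ)
      (measurableSet_closedBall (x := (0 : ℂ)) (ε := r)) f + T' f : L2w φ) := by
  -- Data in radius `r` and a kernel in radius `2` give a convolution in radius `r + 2`, so the
  -- outer cut-off has no effect and creates no error in `∂̄`.
  have hsupp : ∀ κ : ℂ → ℂ, (∀ z, 2 < ‖z‖ → κ z = 0) →
      truncConv r (r + 2) κ f = conv ((Metric.closedBall (0 : ℂ) r).indicator f) κ := by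
    intro κ hκ
    refine Set.indicator_eq_self.2 fun z hz => ?_
    by_contra hmem
    refine hz ?_
    rw [conv_apply]
    refine integral_eq_zero_of_ae (ae_of_all _ fun t => ?_)
    rw [Pi.zero_apply]
    dsimp only
    by_cases ht : t ∈ Metric.closedBall (0 : ℂ) r
    · rw [hκ (z - t), mul_zero]
      rw [mem_closedBall_zero_iff] at hmem ht
      linarith [norm_sub_norm_le z t]
    · rw [Set.indicator_of_notMem ht, zero_mul]
  have h1 := hT f
  have h2 := hT' f
  rw [hsupp k hp.eq_zero] at h1
  rw [hsupp η hp.remainder_eq_zero] at h2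
  refine (hp.hasWeakDbar_conv (integrable_indicator_coe hφ r f)).congr h1.symm ?_
  have h3 := Lp.coeFn_add (indicatorL (weightedMeasure φ)
    (measurableSet_closedBall (x := (0 : ℂ)) (ε := r)) f) (T' f)
  have h4 := coe_indicatorL (μ := weightedMeasure φ)
    (measurableSet_closedBall (x := (0 : ℂ)) (ε := r)) f
  rw [ae_weightedMeasure hφ] at h3 h4
  filter_upwards [h2, h3, h4] with z e2 e3 e4
  rw [e3, Pi.add_apply, e2, e4]

/-- The canonical solution operator is compact on data supported in a fixed disc. -/
lemma isCompactOperator_comp_indicatorL (hφ : Continuous φ) {S : L2w φ →L[ℂ] L2w φ}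
    (hS : ∀ f, HasWeakDbar (S f) f ∧ S f ∈ (rangeDel hφ)ᗮᗮ) (r : ℝ) :
    IsCompactOperator (S ∘L indicatorL (weightedMeasure φ)
      (measurableSet_closedBall (x := (0 : ℂ)) (ε := r))) := by
  obtain ⟨k, η, hp⟩ := exists_parametrix
  obtain ⟨A, -, hA⟩ := exists_isTruncConv hφ r (r + 2)
  obtain ⟨T, hT, -⟩ := hA k hp.integrable
  obtain ⟨T', hT', -⟩ := hA η hp.integrable_remainder
  exact isCompactOperator_comp_of_sub_mem (fun f => (hS f).2)
    (fun f => sub_mem_orthogonal_rangeDel hφ (hasWeakDbar_truncConv hφ hp hT hT' f) (hS _).1)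
    (hT.isCompactOperator hφ hp.integrable) (hT'.isCompactOperator hφ hp.integrable_remainder)

end Canonical

end DbarPlane

end

theorem theorem2p3 (φ : ℂ → ℝ) (hφ : DbarPlane.ClassW φ)
    (hΔ : Tendsto (fun z : ℂ => (Δ φ) z) (cocompact ℂ) atTop) :
    ∃ S : DbarPlane.L2w φ →L[ℂ] DbarPlane.L2w φ,
      DbarPlane.IsCanonicalSolutionOperator φ S ∧
      (∀ T : DbarPlane.L2w φ → DbarPlane.L2w φ,
        DbarPlane.IsCanonicalSolutionOperator φ T → T = S) ∧
      IsCompactOperator S := by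
  have hφc := hφ.contDiff.continuous
  obtain ⟨S, hS, htail⟩ := DbarPlane.exists_solution_operator hφ.contDiff hΔ
  have hA := DbarPlane.A2w_eq_orthogonal_rangeDel hφc
  -- The closure of the range lies in its double complement, which is `(A²_φ)ᗮ`.
  have hS' : ∀ f, DbarPlane.HasWeakDbar (S f) f ∧ S f ∈ (DbarPlane.rangeDel hφc)ᗮᗮ := fun f =>
    ⟨(hS f).1, Submodule.topologicalClosure_minimal _ (Submodule.le_orthogonal_orthogonal _)
      (Submodule.isClosed_orthogonal _) (hS f).2⟩
  refine ⟨S, fun f => ?_, fun T hT => funext fun f => ?_, ?_⟩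
  · rw [hA]
    exact hS' f
  · have hTf := hT f
    rw [hA] at hTf
    -- The difference of two canonical solutions lies in `A²_φ` and in its complement, so it is
    -- orthogonal to itself.
    have h1 := DbarPlane.sub_mem_orthogonal_rangeDel hφc hTf.1 (hS' f).1
    have h2 := Submodule.sub_mem _ hTf.2 (hS' f).2
    rw [← sub_eq_zero, ← inner_self_eq_zero (𝕜 := ℂ)]
    exact Submodule.inner_right_of_mem_orthogonal h1 h2
  -- The tail estimate says that `S` is within `ε / 2` of its restriction to data in a disc, and
  -- that restriction is compact.
  · have hmem : S ∈ closure {T : DbarPlane.L2w φ →L[ℂ] DbarPlane.L2w φ | IsCompactOperator T} := by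
      rw [Metric.mem_closure_iff]
      intro ε hε
      obtain ⟨r, hr⟩ := htail (ε / 2) (by positivity)
      refine ⟨_, DbarPlane.isCompactOperator_comp_indicatorL hφc hS' r, ?_⟩
      rw [dist_eq_norm]
      refine (ContinuousLinearMap.opNorm_le_bound _ (by positivity) fun f => ?_).trans_lt
        (half_lt_self hε)
      rw [sub_apply, ContinuousLinearMap.comp_apply, ← map_sub]
      exact hr f
    rwa [isClosed_setOfPred_isCompactOperator.closure_eq] at hmem
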